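/- Let $d\in\{2,3\}$, let $\Omega\subset\mathbb R^d$ be a polygonal/polyhedral domain and $\mathcal T_h$ a finite conforming triangular/tetrahedral mesh of $\Omega$ with set of edges/faces $\mathcal E_h$. Let $\mathbb A:\Omega\to\mathbb R^{d\times d}$ be symmetric with $\alpha\,\xi^T\xi\le\xi^T\mathbb A(x)\xi\le\beta\,\xi^T\xi$ for all $\xi\in\mathbb R^d$, $x\in\Omega$ (constants $\alpha,\beta>0$), and suppose that $\mathbb A$ is piecewise constant, i.e. constant in the interior of each $K\in\mathcal T_h$. Let $j\ge 0$ and consider one of the following two pairs (where $P_k$ denotes polynomials of degree at most $k$ and $\widehat P_k$ homogeneous polynomials of degree $k$): - Raviart-Thomas: $l=j$ and $G_j(K)=[P_j(K)]^d+\widehat P_j(K)\,\mathbf x$; - Brezzi-Douglas-Marini: $l=j+1$ and $G_j(K)=[P_{j+1}(K)]^d$. Let $V_h$ be the space of pairs $v=\{v_0,v_b\}$ with $v_0|_K\in P_j(K)$ for each $K\in\mathcal T_h$, $v_b|_e\in P_l(e)$ for each $e\in\mathcal E_h$, and $v_b|_e=0$ if $e\subset\partial\Omega$. Let $V_0=\{\{v_0,0\}\in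 V_h\}$ and $V_b=\{\{0,v_b\}\in V_h\}$. The discrete weak gradient of $v$ on $K$ is the unique $\nabla_w v|_K\in G_j(K)$ with $$(\nabla_w v,\mathbf q)_K=-(v_0,\nabla\cdot\mathbf q)_K+\langle v_b,\mathbf q\cdot\mathbf n\rangle_{\partial K}\qquad\text{for all }\mathbf q\in G_j(K),$$ where $\mathbf n$ is the unit outward normal on $\partial K$, and $a_h(u,v)=\sum_{K\in\mathcal T_h}(\mathbb A\nabla_w u,\nabla_w v)_K$. For $v_b\in V_b$ let $P_0v_b\in V_0$ be the unique element with $a_h(P_0v_b,\zeta_0)=a_h(v_b,\zeta_0)$ for all $\zeta_0\in V_0$. Let $\mathcal V_h\subset H_0^1(\Omega)$ be the space of continuous functions that vanish on $\partial\Omega$ and are affine on each $K\in\mathcal T_h$. For $w\in\mathcal V_h$ put $Q_hw=\{Q_0w,Q_bw\}$, where $Q_0w|_K$ and $Q_bw|_e$ are the local $L^2$ projections of $w$ onto $P_j(K)$ and $P_l(e)$, and $\Pi_rw=(I-P_0)Q_bw$, where $Q_bw$ is identified with $\{0,Q_bw\}\in V_b$. Then these objects are well defined (the weak gradients of all $v\in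 V_h$, the elements $P_0v_b$ for all $v_b\in V_b$ and the local $L^2$ projections of $w\in\mathcal V_h$ exist and are unique, and $\{0,Q_bw\}\in V_b$, $Q_hw\in V_h$), and $$Q_hw=\Pi_rw\qquad\text{for all }w\in\mathcal V_h.$$ -/

import Mathlib

open MeasureTheory

noncomputable section

namespace WeakGalerkin

/-- Euclidean space `ℝ^d`. -/
abbrev Pt (d : ℕ) : Type := EuclideanSpace ℝ (Fin d)

/-- The element of a type characterised by a predicate, if there is exactly one; `0` otherwise. -/
def theUnique {α : Type*} [Zero α] (P : α → Prop) : α :=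
  open Classical in if h : ∃! x, P x then h.choose else 0

theorem theUnique_spec {α : Type*} [Zero α] {P : α → Prop} (h : ∃! x, P x) :
    P (theUnique P) := by
  unfold theUnique
  rw [dif_pos h]
  exact h.choose_spec.1

/-! ### Meshes -/

/-- A conforming simplicial mesh of `Ω ⊆ ℝ^d`: a finite geometric simplicial complex in which
every simplex is a face of a `d`-dimensional one, which covers the closure of `Ω`, and whose
`d`-dimensional simplices have their interior in `Ω`. (A simplex is given by its vertices.) -/
structure Mesh (d : ℕ) (Ω : Set (Pt d)) extends Geometry.SimplicialComplex ℝ (Pt d) where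
  finite_faces : faces.Finite
  pure_dim : ∀ s ∈ faces, ∃ K ∈ faces, s ⊆ K ∧ K.card = d + 1
  space_eq : toSimplicialComplex.space = closure Ω
  interior_subset : ∀ K ∈ faces, K.card = d + 1 → interior (convexHull ℝ (K : Set (Pt d))) ⊆ Ω

variable {d : ℕ} {Ω : Set (Pt d)}

/-- The elements (triangles / tetrahedra) of the mesh. -/
def Mesh.Cell (T : Mesh d Ω) : Type := {K : Finset (Pt d) // K ∈ T.faces ∧ K.card = d + 1}

/-- The edges (`d = 2`) or triangular faces (`d = 3`) of the mesh. -/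
def Mesh.Face (T : Mesh d Ω) : Type := {e : Finset (Pt d) // e ∈ T.faces ∧ e.card = d}

instance (T : Mesh d Ω) : Finite T.Cell :=
  (T.finite_faces.subset fun _ h => h.1 : {K | K ∈ T.faces ∧ K.card = d + 1}.Finite).to_subtype

instance (T : Mesh d Ω) : Finite T.Face :=
  (T.finite_faces.subset fun _ h => h.1 : {e | e ∈ T.faces ∧ e.card = d}.Finite).to_subtype

instance (T : Mesh d Ω) : Fintype T.Cell := Fintype.ofFinite _

instance (T : Mesh d Ω) : Fintype T.Face := Fintype.ofFinite _

/-- The vertices of an element. -/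
def Mesh.Cell.verts {T : Mesh d Ω} (K : T.Cell) : Finset (Pt d) := K.1

/-- The vertices of an edge/face. -/
def Mesh.Face.verts {T : Mesh d Ω} (e : T.Face) : Finset (Pt d) := e.1

/-- The closed simplex occupied by an element. -/
def Mesh.Cell.body {T : Mesh d Ω} (K : T.Cell) : Set (Pt d) := convexHull ℝ (K.verts : Set (Pt d))

/-- The closed simplex occupied by an edge/face. -/
def Mesh.Face.body {T : Mesh d Ω} (e : T.Face) : Set (Pt d) := convexHull ℝ (e.verts : Set (Pt d))

/-- The edges/faces that make up `∂K`. -/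
def Mesh.Cell.bdry {T : Mesh d Ω} (K : T.Cell) : Finset T.Face :=
  open Classical in Finset.univ.filter fun e => e.verts ⊆ K.verts

/-- For a face `e` of the simplex `K`, a normal vector of `e` that points out of `K`: the component
orthogonal to `e` of the sum of all vectors from a vertex of `K` to a vertex of `e`. -/
def outwardDirection (K e : Finset (Pt d)) : Pt d :=
  (vectorSpan ℝ (e : Set (Pt d)))ᗮ.starProjection (∑ y ∈ e, ∑ x ∈ K, (y - x))

/-- The unit outward normal of the simplex `K` on its face `e`. -/
def outwardNormal (K e : Finset (Pt d)) : Pt d :=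
  ‖outwardDirection K e‖⁻¹ • outwardDirection K e

/-! ### Polynomials -/

/-- Scalar polynomials in `x₁, …, x_d`. -/
abbrev Poly (d : ℕ) : Type := MvPolynomial (Fin d) ℝ

/-- Vector fields on `ℝ^d` with polynomial components. -/
abbrev VecPoly (d : ℕ) : Type := Fin d → Poly d

/-- Restriction of a polynomial to a set, as a linear map. -/
def restrictTo (s : Set (Pt d)) : Poly d →ₗ[ℝ] (s → ℝ) where
  toFun p x := MvPolynomial.eval (fun i => (x : Pt d) i) p
  map_add' p q := by ext x; simp
  map_smul' c p := by ext x; simp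

/-- `P_k(s)`: the functions on `s` that are polynomials of degree at most `k`. -/
def polyOn (s : Set (Pt d)) (k : ℕ) : Submodule ℝ (s → ℝ) :=
  (MvPolynomial.restrictTotalDegree (Fin d) ℝ k).map (restrictTo s)

/-- The value of a polynomial vector field at a point. -/
def VecPoly.eval (q : VecPoly d) (x : Pt d) : Fin d → ℝ :=
  fun i => MvPolynomial.eval (fun k => x k) (q i)

/-- The divergence of a polynomial vector field. -/
def VecPoly.div (q : VecPoly d) : Poly d := ∑ i, MvPolynomial.pderiv i (q i)

/-- `[P_k]^d`. -/
def vecPolyLE (d k : ℕ) : Submodule ℝ (VecPoly d) :=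
  Submodule.pi Set.univ fun _ => MvPolynomial.restrictTotalDegree (Fin d) ℝ k

/-- Multiplication of a scalar polynomial by the vector field `x = (x₁, …, x_d)`. -/
def mulPosition (d : ℕ) : Poly d →ₗ[ℝ] VecPoly d where
  toFun p i := p * MvPolynomial.X i
  map_add' p q := by funext i; simp [add_mul]
  map_smul' c p := by funext i; simp

/-- The two weak Galerkin pairs: `W_{j,j}` with Raviart-Thomas, `W_{j,j+1}` with
Brezzi-Douglas-Marini. -/
inductive WGPair : Type
  | RT
  | BDM

/-- The degree `l` of the polynomials on edges/faces. -/
def WGPair.faceDegree : WGPair → ℕ → ℕ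
  | .RT, j => j
  | .BDM, j => j + 1

/-- The local space `G_j`. -/
def WGPair.gradSpace (d : ℕ) : WGPair → ℕ → Submodule ℝ (VecPoly d)
  | .RT, j => vecPolyLE d j ⊔ (MvPolynomial.homogeneousSubmodule (Fin d) ℝ j).map (mulPosition d)
  | .BDM, j => vecPolyLE d (j + 1)

/-! ### Weak functions and the weak gradient -/

/-- Weak functions `{v₀, v_b}`: a function on each element and a function on each edge/face. -/
abbrev WeakFun (T : Mesh d Ω) : Type :=
  (∀ K : T.Cell, K.body → ℝ) × (∀ e : T.Face, e.body → ℝ)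

/-- The weak discrete space `V_h`. -/
def Vh (T : Mesh d Ω) (G : WGPair) (j : ℕ) : Submodule ℝ (WeakFun T) where
  carrier := {v | (∀ K, v.1 K ∈ polyOn K.body j) ∧ (∀ e, v.2 e ∈ polyOn e.body (G.faceDegree j)) ∧
    ∀ e : T.Face, e.body ⊆ frontier Ω → v.2 e = 0}
  add_mem' {u v} hu hv := ⟨fun K => add_mem (hu.1 K) (hv.1 K),
    fun e => add_mem (hu.2.1 e) (hv.2.1 e), fun e he => by simp [hu.2.2 e he, hv.2.2 e he]⟩
  zero_mem' := ⟨fun _ => zero_mem _, fun _ => zero_mem _, fun _ _ => rfl⟩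
  smul_mem' c v hv := ⟨fun K => Submodule.smul_mem _ c (hv.1 K),
    fun e => Submodule.smul_mem _ c (hv.2.1 e), fun e he => by simp [hv.2.2 e he]⟩

/-- `V_0`, the `{v₀, 0} ∈ V_h`. -/
def V0 (T : Mesh d Ω) (G : WGPair) (j : ℕ) : Submodule ℝ (WeakFun T) :=
  Vh T G j ⊓ LinearMap.ker (LinearMap.snd ℝ _ _)

/-- `V_b`, the `{0, v_b} ∈ V_h`. -/
def Vb (T : Mesh d Ω) (G : WGPair) (j : ℕ) : Submodule ℝ (WeakFun T) :=
  Vh T G j ⊓ LinearMap.ker (LinearMap.fst ℝ _ _)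

/-- The integral over the set `s`, with respect to `μ`, of a function defined on `s`. -/
def integralOn (μ : Measure (Pt d)) (s : Set (Pt d)) (f : s → ℝ) : ℝ :=
  ∫ x, f x ∂(μ.comap ((↑) : s → Pt d))

/-- The defining property of the weak gradient `g` of `v` on `K`. Integrals over elements are with
respect to Lebesgue measure, integrals over edges/faces with respect to the `(d-1)`-dimensional
surface measure `μHE[d - 1]`. -/
def IsWeakGradient {T : Mesh d Ω} (G : WGPair) (j : ℕ) (v : WeakFun T) (K : T.Cell)
    (g : VecPoly d) : Prop :=
  g ∈ G.gradSpace d j ∧ ∀ q ∈ G.gradSpace d j,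
    ∫ x in K.body, g.eval x ⬝ᵥ q.eval x =
      - integralOn volume K.body (fun x => v.1 K x * restrictTo K.body q.div x) +
      ∑ e ∈ K.bdry, integralOn μHE[d - 1] e.body
        (fun x => v.2 e x * (q.eval x ⬝ᵥ (outwardNormal K.verts e.verts).ofLp))

/-- The discrete weak gradient `∇_w v` on the element `K`. -/
def weakGradient {T : Mesh d Ω} (G : WGPair) (j : ℕ) (v : WeakFun T) (K : T.Cell) : VecPoly d :=
  theUnique (IsWeakGradient G j v K)

/-- The bilinear form `a_h(u, v) = (𝔸 ∇_w u, ∇_w v)`. -/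
def ah {T : Mesh d Ω} (G : WGPair) (j : ℕ) (A : Pt d → Matrix (Fin d) (Fin d) ℝ)
    (u v : WeakFun T) : ℝ :=
  ∑ K : T.Cell, ∫ x in K.body,
    (A x).mulVec ((weakGradient G j u K).eval x) ⬝ᵥ (weakGradient G j v K).eval x

/-! ### Conforming functions, projections and prolongations -/

/-- The `H¹`-conforming `P₁` finite element space: the continuous functions, extended by zero
outside `Ω`, that vanish on `∂Ω` and are affine on each element. -/
def conformingP1 (T : Mesh d Ω) : Submodule ℝ (Pt d → ℝ) where
  carrier := {w | Continuous w ∧ (∀ x ∉ Ω, w x = 0) ∧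
    ∀ K : T.Cell, (fun x : K.body => w x) ∈ polyOn K.body 1}
  add_mem' {u v} hu hv := ⟨hu.1.add hv.1, fun x hx => by simp [hu.2.1 x hx, hv.2.1 x hx],
    fun K => add_mem (hu.2.2 K) (hv.2.2 K)⟩
  zero_mem' := ⟨continuous_const, fun _ _ => rfl, fun _ => zero_mem _⟩
  smul_mem' c v hv := ⟨hv.1.const_smul c, fun x hx => by simp [hv.2.1 x hx],
    fun K => Submodule.smul_mem _ c (hv.2.2 K)⟩

/-- `p` is the `L²(s, μ)`-projection of the function `f` onto `P_k(s)`. -/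
def IsL2Proj (μ : Measure (Pt d)) (s : Set (Pt d)) (k : ℕ) (f : Pt d → ℝ) (p : s → ℝ) : Prop :=
  p ∈ polyOn s k ∧ ∀ r ∈ polyOn s k,
    integralOn μ s (fun x => p x * r x) = integralOn μ s (fun x => f x * r x)

/-- The `L²` projection onto `P_k(s)`. -/
def l2Proj (μ : Measure (Pt d)) (s : Set (Pt d)) (k : ℕ) (f : Pt d → ℝ) : s → ℝ :=
  theUnique (IsL2Proj μ s k f)

/-- `Q_0 w`, the element-wise `L²` projection to degree `j`, as the weak function `{Q_0 w, 0}`. -/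
def Q0 (T : Mesh d Ω) (j : ℕ) (w : Pt d → ℝ) : WeakFun T :=
  (fun K => l2Proj volume K.body j w, 0)

/-- `Q_b w`, the edge/face-wise `L²` projection to degree `l`, as the weak function
`{0, Q_b w}`. -/
def Qb (T : Mesh d Ω) (G : WGPair) (j : ℕ) (w : Pt d → ℝ) : WeakFun T :=
  (0, fun e => l2Proj μHE[d - 1] e.body (G.faceDegree j) w)

/-- `Q_h w = {Q_0 w, Q_b w}`. -/
def Qh (T : Mesh d Ω) (G : WGPair) (j : ℕ) (w : Pt d → ℝ) : WeakFun T :=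
  Q0 T j w + Qb T G j w

/-- The defining property of `u = P_0 v`: `u ∈ V_0` and `a_h(u, ζ) = a_h(v, ζ)` for `ζ ∈ V_0`. -/
def IsP0 {T : Mesh d Ω} (G : WGPair) (j : ℕ) (A : Pt d → Matrix (Fin d) (Fin d) ℝ)
    (v u : WeakFun T) : Prop :=
  u ∈ V0 T G j ∧ ∀ ζ ∈ V0 T G j, ah G j A u ζ = ah G j A v ζ

/-- The `a_h`-orthogonal projector `P_0` to `V_0`. -/
def P0 {T : Mesh d Ω} (G : WGPair) (j : ℕ) (A : Pt d → Matrix (Fin d) (Fin d) ℝ)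
    (v : WeakFun T) : WeakFun T :=
  theUnique (IsP0 G j A v)

/-- The reduced prolongation `Π_r = (I - P_0) Q_b`. -/
def prolongR (T : Mesh d Ω) (G : WGPair) (j : ℕ) (A : Pt d → Matrix (Fin d) (Fin d) ℝ)
    (w : Pt d → ℝ) : WeakFun T :=
  Qb T G j w - P0 G j A (Qb T G j w)

end WeakGalerkin

end

open MeasureTheory

noncomputable section

namespace WeakGalerkin

/-! The heart of the matter is that `∇_w Q_h w` is the ordinary gradient of `w` on each element. For
a test field `q` in `G_j`, `div q` has degree at most `j` and `q · n` has degree at most `l` on each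
face. The two `L²` projections in the definition of the weak gradient may therefore be dropped, and
the divergence theorem for `w q` leaves `(∇w, q)_K` (`exists_weakGradient_Qh_eq_const`).

As `w` is affine and `𝔸` constant on `K`, the flux `𝔸 ∇w` is a constant vector. It is an admissible
test field with zero divergence, so its pairing with `∇_w ζ` vanishes for every `ζ` in `V_0`, which
has no boundary part (`cellForm_weakGradient_const_eq_zero`). Hence `a_h(Q_0 w + Q_b w, ζ) = 0`,
which says that `-Q_0 w` solves the problem defining `P_0 Q_b w`. Uniqueness gives `P_0 Q_b w = -Q_0
w`, and the identity follows (`Qh_eq_prolongR`).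

Existence and uniqueness all come from one fact: a bilinear form with no isotropic vectors on a
finite-dimensional space represents every functional (`exists_linear_representative`). For `P_0`,
definiteness holds because the divergence maps `G_j` onto `P_j` (`exists_div_eq`).

Most of the work is the divergence theorem on a simplex, with Hausdorff measure on the facets
(`Mesh.Cell.integral_div`). It is derived from the fundamental theorem of calculus along one edge in
affine coordinates. The normalising constants of the measures are never computed, only compared. -/

open Module

/-! ### Lebesgue and Hausdorff measure in affine coordinates -/

section Charts
variable {E : Type*} [NormedAddCommGroup E] [InnerProductSpace ℝ E] [MeasurableSpace E]
  [BorelSpace E] [FiniteDimensional ℝ E] {ι : Type*} [Fintype ι]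

/-- The affine chart `t ↦ a + ∑ tᵢ uᵢ`. -/
def chart (a : E) (u : ι → E) (t : ι → ℝ) : E := a + ∑ i, t i • u i

/-- The affine chart `(t, s) ↦ a + ∑ tᵢ uᵢ + s v`. -/
def chartProd (a : E) (u : ι → E) (v : E) (p : (ι → ℝ) × ℝ) : E := chart a u p.1 + p.2 • v

/-- Haar measure on the hyperplane direction is unique up to a factor `k`, and Lebesgue measure on
the whole space is the product of the hyperplane and its normal line. The same `k` thus governs both
formulas. Sharing it is the point: no Gram determinant has to be evaluated. -/
theorem exists_hyperplane_measure_eq (u : ι → E) (hu : LinearIndependent ℝ u) (v : E)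
    (hv : v ∉ Submodule.span ℝ (Set.range u)) (hcard : finrank ℝ E = Fintype.card ι + 1) (a : E) :
    ∃ k : NNReal, k ≠ 0 ∧
      (μHE[Fintype.card ι] : Measure E).restrict (Set.range (chart a u)) =
        k • (volume : Measure (ι → ℝ)).map (chart a u) ∧
      (volume : Measure E) =
        (k * ‖(Submodule.span ℝ (Set.range u))ᗮ.starProjection v‖₊) •
          (volume : Measure ((ι → ℝ) × ℝ)).map (chartProd a u v) := by
  set W := Submodule.span ℝ (Set.range u) with hW
  have hfW : finrank ℝ W = Fintype.card ι := finrank_span_eq_card hu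
  let L : (ι → ℝ) ≃L[ℝ] W := (Basis.span hu).equivFun.symm.toContinuousLinearEquiv
  have hL : ∀ t, (L t : E) = ∑ i, t i • u i := by
    intro t
    simp [L, Basis.equivFun_symm_apply, Basis.span_apply]
  have hmL : Measurable L := L.continuous.measurable
  let ν : Measure W := (volume : Measure (ι → ℝ)).map L
  have hν : ν.IsAddHaarMeasure := L.isAddHaarMeasure_map _
  let k : NNReal := Measure.addHaarScalarFactor (volume : Measure W) ν
  have hk : k ≠ 0 := (Measure.addHaarScalarFactor_pos_of_isAddHaarMeasure _ _).ne'
  have hvolW : (volume : Measure W) = k • ν := Measure.isAddLeftInvariant_eq_smul _ _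
  refine ⟨k, hk, ?_, ?_⟩
  · let ψ : W → E := fun w => a + w
    have hψ : Isometry ψ := by
      intro x y
      simp [ψ, edist_add_left, Subtype.edist_eq]
    have hφ : chart a u = ψ ∘ L := by
      funext t; simp [ψ, chart, hL]
    have hr : Set.range (chart a u) = Set.range ψ := by
      rw [hφ, Set.range_comp, L.surjective.range_eq, Set.image_univ]
    rw [hr, ← hψ.map_euclideanHausdorffMeasure, ← hfW,
      InnerProductSpace.euclideanHausdorffMeasure_eq_volume, hvolW, Measure.map_smul, hφ,
      ← Measure.map_map hψ.continuous.measurable hmL]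
  · have hf1 : finrank ℝ Wᗮ = 1 := by
      have := W.finrank_add_finrank_orthogonal
      omega
    let v' : Wᗮ := Wᗮ.orthogonalProjectionOnto v
    have hv' : v' ≠ 0 := by
      intro h
      apply hv
      have := (Submodule.orthogonalProjectionOnto_eq_zero_iff (K := Wᗮ) (v := v)).1 h
      simpa [Submodule.orthogonal_orthogonal] using this
    have hvolP := volume_eq_of_finrank_eq_one hf1 hv'
    have hnorm : ‖Wᗮ.starProjection v‖₊ = ‖v'‖₊ := by
      rw [Submodule.starProjection_apply]; rfl
    have hmp := W.measurePreserving_measurableEquivProd a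
    rw [InnerProductSpace.euclideanHausdorffMeasure_eq_volume] at hmp
    have hmpr : (volume : Measure E) = Measure.map (W.measurableEquivProd a).symm volume :=
      hmp.symm.map_eq.symm
    -- The coordinates of the tangential part of `v`. A measure-preserving shear by `c` reduces the
    -- oblique direction `v` to its orthogonal part `v'`.
    let c : ι → ℝ := L.symm (W.orthogonalProjectionOnto v)
    have hshear : MeasurePreserving (fun p : (ι → ℝ) × ℝ => (p.1 + p.2 • c, p.2))
        (volume.prod volume) (volume.prod volume) := by
      have h1 : MeasurePreserving (fun p : ℝ × (ι → ℝ) => (p.1, p.2 + p.1 • c))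
          (volume.prod volume) (volume.prod volume) :=
        (MeasurePreserving.id _).skew_product (g := fun s x => x + s • c)
          (by unfold Function.uncurry; fun_prop) (Filter.Eventually.of_forall fun s => (measurePreserving_add_right _ _).map_eq)
      exact (Measure.measurePreserving_swap.comp h1).comp Measure.measurePreserving_swap
    have hms : Measurable fun s : ℝ => s • v' := by fun_prop
    have hcomp : chartProd a u v = (W.measurableEquivProd a).symm ∘
        Prod.map L (fun s : ℝ => s • v') ∘ (fun p : (ι → ℝ) × ℝ => (p.1 + p.2 • c, p.2)) := by
      funext p
      have h2 : v = (W.orthogonalProjectionOnto v : E) + (v' : E) :=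
        (W.starProjection_add_starProjection_orthogonal v).symm
      have h3 : ((L c : W) : E) = W.orthogonalProjectionOnto v := by simp [c]
      have h4 : ((L (p.1 + p.2 • c) : W) : E) =
          ∑ i, p.1 i • u i + p.2 • (W.orthogonalProjectionOnto v : E) := by
        rw [map_add, map_smul, Submodule.coe_add, Submodule.coe_smul, h3, hL]
      simp only [chartProd, chart, Function.comp_apply, Prod.map_apply,
        Submodule.measurableEquivProd_symm_apply, h4, Submodule.coe_smul, vadd_eq_add]
      nth_rw 1 [h2]
      module
    rw [hmpr, hcomp, hnorm, ← Measure.map_map (by fun_prop) (by fun_prop),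
      ← Measure.map_map (by fun_prop) hshear.measurable]
    rw [Measure.volume_eq_prod (ι → ℝ) ℝ, hshear.map_eq, ← Measure.map_prod_map _ _ hmL hms,
      ← Measure.map_smul, Measure.volume_eq_prod, hvolP, hvolW]
    have hsm : ((k • ν).prod (‖v'‖ₑ • Measure.map (fun s : ℝ => s • v') volume)) =
        (k * ‖v'‖₊) • ν.prod (Measure.map (fun s : ℝ => s • v') volume) := by
      rw [Measure.prod_smul_left, show ‖v'‖ₑ = ((‖v'‖₊ : NNReal) : ENNReal) from rfl,
        ← ENNReal.smul_def, Measure.prod_smul_right, smul_smul]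
    exact congrArg _ hsm
end Charts

/-! ### The corner simplex and Fubini on it -/

section UnitSimplex
variable (ι : Type*) [Fintype ι]

/-- The corner simplex `{t ≥ 0, ∑ tᵢ ≤ 1}`. -/
def cornerSimplex : Set (ι → ℝ) := {t | (∀ i, 0 ≤ t i) ∧ ∑ i, t i ≤ 1}

/-- The corner simplex with one coordinate singled out. -/
def cornerSimplexProd : Set ((ι → ℝ) × ℝ) :=
  {p | (∀ i, 0 ≤ p.1 i) ∧ 0 ≤ p.2 ∧ ∑ i, p.1 i + p.2 ≤ 1}

theorem convex_cornerSimplex : Convex ℝ (cornerSimplex ι) := by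
  intro x hx y hy a b ha hb hab
  refine ⟨fun i => ?_, ?_⟩
  · have := hx.1 i; have := hy.1 i
    simp only [Pi.add_apply, Pi.smul_apply, smul_eq_mul]
    positivity
  · have := hx.2; have := hy.2
    simp only [Pi.add_apply, Pi.smul_apply, smul_eq_mul, Finset.sum_add_distrib, ← Finset.mul_sum]
    nlinarith

theorem isCompact_cornerSimplex : IsCompact (cornerSimplex ι) := by
  refine (isCompact_Icc (a := (0 : ι → ℝ)) (b := 1)).of_isClosed_subset ?_ ?_
  · unfold cornerSimplex
    simp only [Set.ofPred_and, Set.ofPred_forall]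
    refine (isClosed_iInter fun i => isClosed_le ?_ ?_).inter (isClosed_le ?_ ?_) <;> fun_prop
  · intro t ht
    exact ⟨fun i => ht.1 i, fun i =>
      (Finset.single_le_sum (fun j _ => ht.1 j) (Finset.mem_univ i)).trans ht.2⟩

theorem isCompact_cornerSimplexProd : IsCompact (cornerSimplexProd ι) := by
  refine (isCompact_Icc (a := (0 : (ι → ℝ) × ℝ)) (b := 1)).of_isClosed_subset ?_ ?_
  · unfold cornerSimplexProd
    simp only [Set.ofPred_and, Set.ofPred_forall]
    refine (isClosed_iInter fun i => isClosed_le ?_ ?_).inter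
      ((isClosed_le ?_ ?_).inter (isClosed_le ?_ ?_)) <;> fun_prop
  · rintro ⟨t, s⟩ ⟨h1, h2, h3⟩
    simp only at h1 h2 h3
    have h4 : 0 ≤ ∑ i, t i := Finset.sum_nonneg fun i _ => h1 i
    refine ⟨⟨fun i => h1 i, h2⟩, ⟨fun i => ?_, ?_⟩⟩
    · have := Finset.single_le_sum (fun j _ => h1 j) (Finset.mem_univ i)
      change t i ≤ 1
      linarith
    · change s ≤ 1
      linarith

theorem interior_cornerSimplex_nonempty : (interior (cornerSimplex ι)).Nonempty := by
  let U : Set (ι → ℝ) := {t | (∀ i, 0 < t i) ∧ ∑ i, t i < 1}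
  have hU : IsOpen U := by
    simp only [U, Set.ofPred_and, Set.ofPred_forall]
    refine (isOpen_iInter_of_finite fun i => isOpen_lt ?_ ?_).inter (isOpen_lt ?_ ?_) <;> fun_prop
  have hsub : U ⊆ cornerSimplex ι := fun t ht => ⟨fun i => (ht.1 i).le, ht.2.le⟩
  refine ⟨fun _ => 1 / (Fintype.card ι + 1 : ℝ), interior_maximal hsub hU ⟨fun i => ?_, ?_⟩⟩
  · positivity
  · simp only [Finset.sum_const, Finset.card_univ, nsmul_eq_mul]
    rw [mul_one_div, div_lt_one (by positivity)]
    linarith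

variable {ι}

theorem setIntegral_cornerSimplexProd {g : (ι → ℝ) × ℝ → ℝ} (hg : Continuous g) :
    ∫ p in cornerSimplexProd ι, g p =
      ∫ t in cornerSimplex ι, ∫ s in (0 : ℝ)..(1 - ∑ i, t i), g (t, s) := by
  have hm := (isCompact_cornerSimplexProd ι).measurableSet
  have hint : Integrable ((cornerSimplexProd ι).indicator g) (volume.prod volume) :=
    (integrable_indicator_iff hm).2 (hg.continuousOn.integrableOn_compact
      (isCompact_cornerSimplexProd ι))
  rw [← integral_indicator hm, Measure.volume_eq_prod, integral_prod _ hint,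
    ← integral_indicator (isCompact_cornerSimplex ι).measurableSet]
  congr 1
  funext t
  by_cases ht : t ∈ cornerSimplex ι
  · have h0 : 0 ≤ 1 - ∑ i, t i := by linarith [ht.2]
    rw [Set.indicator_of_mem ht, intervalIntegral.integral_of_le h0, ← integral_Icc_eq_integral_Ioc,
      ← integral_indicator measurableSet_Icc]
    congr 1
    funext s
    by_cases hs : s ∈ Set.Icc 0 (1 - ∑ i, t i)
    · rw [Set.indicator_of_mem hs, Set.indicator_of_mem]
      exact ⟨ht.1, hs.1, by linarith [hs.2]⟩
    · rw [Set.indicator_of_notMem hs, Set.indicator_of_notMem]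
      exact fun h => hs ⟨h.2.1, by linarith [h.2.2]⟩
  · rw [Set.indicator_of_notMem ht, ← integral_zero]
    congr 1
    funext s
    rw [Set.indicator_of_notMem]
    exact fun h => ht ⟨h.1, by linarith [h.2.1, h.2.2]⟩

end UnitSimplex

/-! ### Simplices as injective images of the corner simplex -/

section ChartImages
variable {E : Type*} [NormedAddCommGroup E] [InnerProductSpace ℝ E] {ι : Type*} [Fintype ι]

theorem chart_image_cornerSimplex (a : E) (u : ι → E) :
    chart a u '' cornerSimplex ι = convexHull ℝ (insert a (Set.range fun i => a + u i)) := by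
  classical
  apply Set.Subset.antisymm
  · rintro _ ⟨t, ht, rfl⟩
    have h := (convex_convexHull ℝ (insert a (Set.range fun i => a + u i))).sum_mem
      (t := Finset.univ) (w := fun o : Option ι => o.elim (1 - ∑ i, t i) t)
      (z := fun o : Option ι => o.elim a (fun i => a + u i)) ?_ ?_ ?_
    · convert h using 1
      simp only [chart, Fintype.sum_option, Option.elim, smul_add, Finset.sum_add_distrib,
        ← Finset.sum_smul]
      module
    · rintro (_ | i) -
      · exact sub_nonneg.2 ht.2
      · exact ht.1 i
    · simp
    · rintro (_ | i) -
      · exact subset_convexHull ℝ _ (Set.mem_insert _ _)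
      · exact subset_convexHull ℝ _ (Set.mem_insert_of_mem _ ⟨i, rfl⟩)
  · refine convexHull_min ?_ ?_
    · rw [Set.insert_subset_iff]
      refine ⟨⟨0, ⟨fun _ => le_rfl, by simp⟩, by simp [chart]⟩, ?_⟩
      rintro _ ⟨i, rfl⟩
      refine ⟨Pi.single i 1, ⟨fun j => ?_, ?_⟩, ?_⟩
      · rcases eq_or_ne j i with rfl | h <;> simp [*]
      · simp
      · simp [chart, Pi.single_apply]
    · rintro _ ⟨x, hx, rfl⟩ _ ⟨y, hy, rfl⟩ α β hα hβ hαβ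
      refine ⟨α • x + β • y, convex_cornerSimplex ι hx hy hα hβ hαβ, ?_⟩
      simp only [chart, Pi.add_apply, Pi.smul_apply, smul_eq_mul, add_smul, mul_smul,
        Finset.sum_add_distrib, ← Finset.smul_sum, smul_add]
      nth_rw 1 [← one_smul ℝ a, ← hαβ]
      module

theorem chartProd_image_cornerSimplexProd (a : E) (u : ι → E) (v : E) :
    chartProd a u v '' cornerSimplexProd ι =
      convexHull ℝ (insert a (insert (a + v) (Set.range fun i => a + u i))) := by
  have hr : insert (a + v) (Set.range fun i => a + u i) =
      Set.range fun o : Option ι => a + o.elim v u := by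
    ext x; simp [Set.mem_range, Option.exists, eq_comm]
  rw [hr, ← chart_image_cornerSimplex]
  ext x
  constructor
  · rintro ⟨p, ⟨h1, h2, h3⟩, rfl⟩
    refine ⟨fun o => o.elim p.2 p.1, ⟨?_, ?_⟩, ?_⟩
    · rintro (_ | i)
      · exact h2
      · exact h1 i
    · simpa [Fintype.sum_option, add_comm] using h3
    · simp only [chart, chartProd, Fintype.sum_option, Option.elim]
      module
  · rintro ⟨t, ⟨h1, h2⟩, rfl⟩
    refine ⟨(fun i => t (some i), t none), ⟨fun i => h1 _, h1 _, ?_⟩, ?_⟩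
    · simpa [Fintype.sum_option, add_comm] using h2
    · simp only [chart, chartProd, Fintype.sum_option, Option.elim]
      module

@[fun_prop]
theorem continuous_chart (a : E) (u : ι → E) : Continuous (chart a u) := by
  unfold chart; fun_prop

@[fun_prop]
theorem continuous_chartProd (a : E) (u : ι → E) (v : E) : Continuous (chartProd a u v) := by
  unfold chartProd; fun_prop

theorem chart_injective {u : ι → E} (hu : LinearIndependent ℝ u) (a : E) :
    Function.Injective (chart a u) := by
  intro s t h
  funext i
  have h' : ∑ i, (s i - t i) • u i = 0 := by
    simpa [chart, sub_smul, sub_eq_zero] using h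
  exact sub_eq_zero.1 (Fintype.linearIndependent_iff.1 hu _ h' i)

theorem chartProd_injective {u : ι → E} (hu : LinearIndependent ℝ u) {v : E}
    (hv : v ∉ Submodule.span ℝ (Set.range u)) (a : E) :
    Function.Injective (chartProd a u v) := by
  rintro ⟨s, x⟩ ⟨t, y⟩ h
  have hxy : x = y := by
    by_contra hne
    apply hv
    have h1 : v = (x - y)⁻¹ • ∑ i, (t i - s i) • u i := by
      rw [eq_inv_smul_iff₀ (sub_ne_zero.2 hne)]
      simp only [chartProd, chart, add_assoc, add_right_inj] at h
      simp only [sub_smul, Finset.sum_sub_distrib]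
      rw [sub_eq_sub_iff_add_eq_add, add_comm, h, add_comm]
    rw [h1]
    exact Submodule.smul_mem _ _ (Submodule.sum_mem _ fun i _ =>
      Submodule.smul_mem _ _ (Submodule.subset_span ⟨i, rfl⟩))
  subst hxy
  have := chart_injective hu a (add_right_cancel h : chart a u s = chart a u t)
  rw [this]

end ChartImages

/-! ### Integration over a simplex and one of its facets -/

section SimplexCharts
variable {E : Type*} [NormedAddCommGroup E] [InnerProductSpace ℝ E]

theorem linearIndependent_of_affineIndependent_insert [DecidableEq E] {a b : E} {r : Finset E}
    (ha : a ∉ r) (hb : b ∉ r) (hab : a ≠ b)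
    (hind : AffineIndependent ℝ ((↑) : (insert a (insert b r) : Finset E) → E)) :
    LinearIndependent ℝ (fun i : r => (i : E) - a) ∧
      b - a ∉ Submodule.span ℝ (Set.range fun i : r => (i : E) - a) := by
  have h1 := (affineIndependent_iff_linearIndependent_vsub ℝ _
    (⟨a, by simp⟩ : (insert a (insert b r) : Finset E))).1 hind
  let g : Option r → {x : (insert a (insert b r) : Finset E) // x ≠ ⟨a, by simp⟩} := fun o =>
    o.elim ⟨⟨b, by simp⟩, fun h => hab (congrArg Subtype.val h).symm⟩
      fun i => ⟨⟨i, by simp⟩, fun h => ha (by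
        have := congrArg Subtype.val h
        simp only at this
        exact this ▸ i.2)⟩
  have hg : Function.Injective g := by
    rintro (_ | i) (_ | j) h
    · rfl
    · exact absurd (congrArg (fun x => (x.1 : E)) h) (fun h' => hb (by
        simp only [g, Option.elim] at h'; exact h' ▸ j.2))
    · exact absurd (congrArg (fun x => (x.1 : E)) h) (fun h' => hb (by
        simp only [g, Option.elim] at h'; exact h' ▸ i.2))
    · have h' := congrArg (fun x => (x.1 : E)) h
      simp only [g, Option.elim] at h'
      exact congrArg some (Subtype.ext h')
  have h2 := h1.comp g hg
  have h3 : LinearIndependent ℝ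
      (fun o : Option r => Option.casesOn' o (b - a) (fun i : r => (i : E) - a)) := by
    have : (fun o : Option r => Option.casesOn' o (b - a) (fun i : r => (i : E) - a)) = (fun i => ((i.1 : E) -ᵥ a)) ∘ g := by
      funext o
      cases o <;> rfl
    rw [this]
    exact h2
  exact linearIndependent_option'.1 h3

theorem vectorSpan_insert_eq_span_range_sub [DecidableEq E] (a : E) (r : Finset E) :
    vectorSpan ℝ ((insert a r : Finset E) : Set E) =
      Submodule.span ℝ (Set.range fun i : r => (i : E) - a) := by
  rw [vectorSpan_eq_span_vsub_set_right ℝ (p := a) (by simp), Finset.coe_insert,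
    Set.image_insert_eq, vsub_self, Submodule.span_insert_zero]
  congr 1
  ext x
  simp

theorem chart_image_eq_convexHull [DecidableEq E] (a : E) (r : Finset E) :
    chart a (fun i : r => (i : E) - a) '' cornerSimplex r =
      convexHull ℝ ((insert a r : Finset E) : Set E) := by
  rw [chart_image_cornerSimplex, Finset.coe_insert]
  congr 2
  ext x; simp

/-- The fundamental theorem of calculus along the edge `b - a` of a simplex, without identifying
the constants with surface measures. -/
theorem integral_cornerSimplexProd_deriv {ι : Type*} [Fintype ι] (a : E) (u : ι → E) (v : E)
    {f g : E → ℝ} (hf : Continuous f) (hg : Continuous g)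
    (hfg : ∀ x s, HasDerivAt (fun s : ℝ => f (x + s • v)) (g (x + s • v)) s) :
    ∫ p in cornerSimplexProd ι, g (chartProd a u v p) =
      (∫ t in cornerSimplex ι, f (chart (a + v) (fun i => u i - v) t)) -
        ∫ t in cornerSimplex ι, f (chart a u t) := by
  rw [setIntegral_cornerSimplexProd (by fun_prop), ← integral_sub]
  · congr 1
    funext t
    have h := intervalIntegral.integral_eq_sub_of_hasDerivAt
      (a := 0) (b := 1 - ∑ i, t i) (fun s _ => hfg (chart a u t) s)
      (by apply Continuous.intervalIntegrable; fun_prop)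
    simp only [chartProd]
    rw [h]
    -- At the upper endpoint `s = 1 - ∑ tᵢ` the fibre meets the facet opposite `a`, which is the
    -- corner simplex based at `a + v` with edges `u i - v`.
    congr 2
    · simp only [chart, smul_sub, Finset.sum_sub_distrib, ← Finset.sum_smul]
      module
    · simp
  · exact (Continuous.continuousOn (by fun_prop)).integrableOn_compact (isCompact_cornerSimplex ι)
  · exact (Continuous.continuousOn (by fun_prop)).integrableOn_compact (isCompact_cornerSimplex ι)

variable [MeasurableSpace E] [BorelSpace E] [FiniteDimensional ℝ E]

/-- The facet opposite `b` and the full simplex are integrated with one constant `k`; the extra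
factor for the simplex is the height of `b` above that facet. This height reappears as the pairing
of `b - a` with the normal, which is what turns the calculus along an edge into a flux formula. -/
theorem exists_simplex_chart [DecidableEq E] {a b : E} {r : Finset E}
    (ha : a ∉ r) (hb : b ∉ r) (hab : a ≠ b)
    (hind : AffineIndependent ℝ ((↑) : (insert a (insert b r) : Finset E) → E))
    (hcard : finrank ℝ E = r.card + 1) :
    ∃ k : ℝ, 0 < k ∧
      μHE[r.card] (convexHull ℝ ((insert a r : Finset E) : Set E)) < ⊤ ∧
      (∀ f : E → ℝ, ∫ x in convexHull ℝ ((insert a r : Finset E) : Set E), f x ∂μHE[r.card] =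
        k * ∫ t in cornerSimplex r, f (chart a (fun i : r => (i : E) - a) t)) ∧
      ∀ f : E → ℝ, ∫ x in convexHull ℝ ((insert a (insert b r) : Finset E) : Set E), f x =
        k * ‖(vectorSpan ℝ ((insert a r : Finset E) : Set E))ᗮ.starProjection (b - a)‖ *
          ∫ p in cornerSimplexProd r, f (chartProd a (fun i : r => (i : E) - a) (b - a) p) := by
  obtain ⟨hu, hv⟩ := linearIndependent_of_affineIndependent_insert ha hb hab hind
  set u := fun i : r => (i : E) - a with hu_def
  have hcard' : finrank ℝ E = Fintype.card r + 1 := by simpa using hcard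
  obtain ⟨k, hk, h1, h2⟩ := exists_hyperplane_measure_eq u hu (b - a) hv hcard' a
  rw [Fintype.card_coe] at h1
  have himg : chart a u '' cornerSimplex r = convexHull ℝ ((insert a r : Finset E) : Set E) :=
    chart_image_eq_convexHull a r
  have himgP : chartProd a u (b - a) '' cornerSimplexProd r =
      convexHull ℝ ((insert a (insert b r) : Finset E) : Set E) := by
    rw [chartProd_image_cornerSimplexProd, Finset.coe_insert, Finset.coe_insert, add_sub_cancel]
    congr 3
    ext x; simp [u]
  have hinj := chart_injective hu a
  have hinjP := chartProd_injective hu hv a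
  have hme : MeasurableEmbedding (chart a u) :=
    (continuous_chart a u).measurableEmbedding hinj
  have hmeP : MeasurableEmbedding (chartProd a u (b - a)) :=
    (continuous_chartProd a u _).measurableEmbedding hinjP
  have hms : MeasurableSet (convexHull ℝ ((insert a r : Finset E) : Set E)) :=
    (Set.Finite.isCompact_convexHull (𝕜 := ℝ) (insert a r : Finset E).finite_toSet).measurableSet
  have hres : (μHE[r.card] : Measure E).restrict (convexHull ℝ ((insert a r : Finset E) : Set E)) =
      k • (Measure.map (chart a u) volume).restrict
        (convexHull ℝ ((insert a r : Finset E) : Set E)) := by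
    rw [← Measure.restrict_smul, ← h1, Measure.restrict_restrict hms, Set.inter_eq_left.2]
    rw [← himg]
    exact Set.image_subset_range _ _
  refine ⟨k, NNReal.coe_pos.2 (pos_iff_ne_zero.2 hk), ?_, fun f => ?_, fun f => ?_⟩
  · rw [← Measure.restrict_apply_self, hres, ← himg, Measure.smul_apply,
      Measure.restrict_apply_self, hme.map_apply, hinj.preimage_image, ENNReal.smul_def, smul_eq_mul]
    exact ENNReal.mul_lt_top ENNReal.coe_lt_top (isCompact_cornerSimplex r).measure_lt_top
  · rw [hres, integral_smul_nnreal_measure, hme.setIntegral_map, ← himg, hinj.preimage_image]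
    rfl
  · rw [h2, Measure.restrict_smul, integral_smul_nnreal_measure, hmeP.setIntegral_map, ← himgP,
      hinjP.preimage_image, vectorSpan_insert_eq_span_range_sub]
    rfl

end SimplexCharts

open RealInnerProductSpace

variable {d : ℕ}

/-! ### The outward normal of a facet -/

section Normals

/-- Vectors between vertices of `e` are killed by the projection, so each `y` in `e` contributes the
same term, coming from the opposite vertex `b`. The sum is a positive multiple of one projection,
and normalising removes the multiple. -/
theorem outwardNormal_insert [DecidableEq (Pt d)] {e : Finset (Pt d)} {a b : Pt d} (ha : a ∈ e)
    (hb : b ∉ e) :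
    outwardNormal (insert b e) e =
      -(‖(vectorSpan ℝ (e : Set (Pt d)))ᗮ.starProjection (b - a)‖⁻¹ •
        (vectorSpan ℝ (e : Set (Pt d)))ᗮ.starProjection (b - a)) := by
  set P := (vectorSpan ℝ (e : Set (Pt d)))ᗮ.starProjection with hP
  have h0 : ∀ x ∈ e, ∀ y ∈ e, P (y - x) = 0 := by
    intro x hx y hy
    refine (Submodule.starProjection_apply_eq_zero_iff _).2 ?_
    rw [Submodule.orthogonal_orthogonal]
    exact vsub_mem_vectorSpan ℝ hy hx
  have hdir : outwardDirection (insert b e) e = -((e.card : ℝ) • P (b - a)) := by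
    unfold outwardDirection
    rw [map_sum, ← hP]
    have : ∀ y ∈ e, P (∑ x ∈ insert b e, (y - x)) = -P (b - a) := by
      intro y hy
      rw [Finset.sum_insert hb, map_add, map_sum, Finset.sum_eq_zero fun x hx => h0 x hx y hy,
        add_zero, ← map_neg, neg_sub, ← sub_add_sub_cancel y a b, map_add, h0 a ha y hy, zero_add]
    rw [Finset.sum_congr rfl this, Finset.sum_const, smul_neg, Nat.cast_smul_eq_nsmul]
  have hc : (e.card : ℝ) ≠ 0 := Nat.cast_ne_zero.2 (Finset.card_ne_zero_of_mem ha)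
  unfold outwardNormal
  rw [hdir, norm_neg, norm_smul, smul_neg, smul_smul, mul_inv, mul_right_comm, Real.norm_natCast,
    inv_mul_cancel₀ hc, one_mul]

theorem inner_outwardNormal_insert [DecidableEq (Pt d)] {e : Finset (Pt d)} {a b : Pt d}
    (ha : a ∈ e) (hb : b ∉ e) :
    ⟪b - a, outwardNormal (insert b e) e⟫ =
      -‖(vectorSpan ℝ (e : Set (Pt d)))ᗮ.starProjection (b - a)‖ := by
  rw [outwardNormal_insert ha hb, inner_neg_right, inner_smul_right]
  set w := (vectorSpan ℝ (e : Set (Pt d)))ᗮ.starProjection (b - a) with hw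
  have h : ⟪b - a, w⟫ = ‖w‖ * ‖w‖ := by
    have hP : (vectorSpan ℝ (e : Set (Pt d)))ᗮ.starProjection w = w :=
      Submodule.starProjection_eq_self_iff.2 (Submodule.starProjection_apply_mem _ _)
    rw [← real_inner_self_eq_norm_mul_norm]
    nth_rw 1 [← hP]
    rw [← Submodule.inner_starProjection_left_eq_right]
  rw [h]
  -- No affine independence is assumed here; in the degenerate case both sides vanish because `0⁻¹ =
  -- 0`.
  rcases eq_or_ne ‖w‖ 0 with h0 | h0
  · simp [h0]
  · field_simp

theorem inner_outwardNormal_eq_zero {K e : Finset (Pt d)} {w : Pt d}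
    (hw : w ∈ vectorSpan ℝ (e : Set (Pt d))) : ⟪w, outwardNormal K e⟫ = 0 := by
  unfold outwardNormal outwardDirection
  rw [inner_smul_right, Submodule.inner_right_of_mem_orthogonal hw, mul_zero]
  exact Submodule.starProjection_apply_mem _ _

end Normals

/-! ### The divergence theorem on a simplex -/

section Divergence

theorem interior_convexHull_nonempty {K : Finset (Pt d)}
    (hind : AffineIndependent ℝ ((↑) : K → Pt d)) (hcard : K.card = d + 1) :
    (interior (convexHull ℝ (K : Set (Pt d)))).Nonempty := by
  rw [interior_convexHull_nonempty_iff_affineSpan_eq_top]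
  have := hind.affineSpan_eq_top_iff_card_eq_finrank_add_one.2 (by simpa using hcard)
  simpa using this

/-- Every facet containing both `a` and `b` has its normal orthogonal to `b - a`, so only the facets
opposite `a` and `b` contribute. The fundamental theorem of calculus along `b - a` produces exactly
the difference of these two facet integrals. -/
theorem integral_deriv_edge [DecidableEq (Pt d)] {K : Finset (Pt d)}
    (hind : AffineIndependent ℝ ((↑) : K → Pt d)) (hcard : K.card = d + 1) {a b : Pt d}
    (ha : a ∈ K) (hb : b ∈ K)
    {f g : Pt d → ℝ} (hf : Continuous f) (hg : Continuous g)
    (hfg : ∀ x s, HasDerivAt (fun s : ℝ => f (x + s • (b - a))) (g (x + s • (b - a))) s) :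
    ∫ x in convexHull ℝ (K : Set (Pt d)), g x =
      ∑ c ∈ K, (∫ x in convexHull ℝ ((K.erase c : Finset (Pt d)) : Set (Pt d)),
        f x ∂μHE[d - 1]) * ⟪b - a, outwardNormal K (K.erase c)⟫ := by
  rcases eq_or_ne a b with rfl | hab
  · have : ∀ x, g x = 0 := by
      intro x
      have h := hfg x 0
      simp only [sub_self, smul_zero, add_zero] at h
      exact h.unique (hasDerivAt_const _ _)
    simp [this]
  have hvol : (volume : Measure (Pt d)).real (convexHull ℝ (K : Set (Pt d))) ≠ 0 := by
    have h1 := (interior_convexHull_nonempty hind hcard)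
    have hc := Set.Finite.isCompact_convexHull (𝕜 := ℝ) K.finite_toSet
    rw [measureReal_def, ENNReal.toReal_ne_zero]
    exact ⟨(Measure.measure_pos_of_nonempty_interior _ h1).ne', hc.measure_lt_top.ne⟩
  obtain ⟨r, hra, hrb, rfl⟩ : ∃ r, a ∉ r ∧ b ∉ r ∧ K = insert a (insert b r) := by
    refine ⟨(K.erase a).erase b, by simp, by simp, ?_⟩
    rw [Finset.insert_erase (Finset.mem_erase.2 ⟨hab.symm, hb⟩), Finset.insert_erase ha]
  have hcr : r.card + 1 = d := by
    rw [Finset.card_insert_of_notMem (by simp [hab, hra]), Finset.card_insert_of_notMem hrb] at hcard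
    omega
  have hd1 : d - 1 = r.card := by omega
  have hfin : finrank ℝ (Pt d) = r.card + 1 := by simp [hcr]
  have hea : (insert a (insert b r)).erase a = insert b r :=
    Finset.erase_insert (by simp [hab, hra])
  have heb : (insert a (insert b r)).erase b = insert a r := by
    rw [Finset.insert_comm, Finset.erase_insert (by simp [hab.symm, hrb])]
  obtain ⟨k₁, hk₁, -, hF₁, hV₁⟩ := exists_simplex_chart hra hrb hab hind hfin
  have hind' := hind
  rw [Finset.insert_comm] at hind'
  obtain ⟨k₂, hk₂, -, hF₂, hV₂⟩ := exists_simplex_chart hrb hra hab.symm hind' hfin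
  rw [Finset.insert_comm b a] at hV₂
  -- Both products are the Jacobian of a chart of the same simplex, based at `a` and at `b`
  -- respectively. Integrating `1` in both charts and cancelling the nonzero volume of the corner
  -- simplex identifies them, so both facet terms carry one constant.
  have hc : k₁ * ‖(vectorSpan ℝ ((insert a r : Finset (Pt d)) : Set (Pt d)))ᗮ.starProjection
      (b - a)‖ = k₂ * ‖(vectorSpan ℝ ((insert b r : Finset (Pt d)) : Set (Pt d)))ᗮ.starProjection
      (a - b)‖ := by
    have e1 := hV₁ fun _ => 1
    have e2 := hV₂ fun _ => 1
    rw [setIntegral_const, smul_eq_mul, mul_one] at e1 e2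
    have e3 := e1.symm.trans e2
    refine mul_right_cancel₀ (fun h0 => hvol ?_) e3
    rw [e1, h0, mul_zero]
  have hn₁ : ⟪b - a, outwardNormal (insert a (insert b r)) (insert a r)⟫ =
      -‖(vectorSpan ℝ ((insert a r : Finset (Pt d)) : Set (Pt d)))ᗮ.starProjection (b - a)‖ := by
    rw [Finset.insert_comm]
    exact inner_outwardNormal_insert (by simp) (by simp [hab.symm, hrb])
  have hn₂ : ⟪b - a, outwardNormal (insert a (insert b r)) (insert b r)⟫ =
      ‖(vectorSpan ℝ ((insert b r : Finset (Pt d)) : Set (Pt d)))ᗮ.starProjection (a - b)‖ := by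
    rw [← neg_sub a b, inner_neg_left,
      inner_outwardNormal_insert (by simp) (by simp [hab, hra]), neg_neg]
  rw [Finset.sum_insert (by simp [hab, hra]), Finset.sum_insert hrb, Finset.sum_eq_zero, hea, heb,
    hn₁, hn₂, hd1, hF₁, hF₂, hV₁, integral_cornerSimplexProd_deriv _ _ _ hf hg hfg]
  · have hch : ∀ t, chart (a + (b - a)) (fun i : r => (i : Pt d) - a - (b - a)) t =
        chart b (fun i : r => (i : Pt d) - b) t := by
      intro t
      simp [chart]
    simp only [hch]
    rw [mul_sub]
    nth_rw 1 [hc]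
    ring
  · intro c hcr'
    rw [inner_outwardNormal_eq_zero, mul_zero]
    refine vsub_mem_vectorSpan ℝ ?_ ?_
    · have : b ≠ c := fun h => hrb (h ▸ hcr')
      simp [this]
    · have : a ≠ c := fun h => hra (h ▸ hcr')
      simp [this]

theorem hasDerivAt_eval_line (p : Poly d) (x v : Pt d) (s : ℝ) :
    HasDerivAt (fun s : ℝ => MvPolynomial.eval (fun i => (x + s • v) i) p)
      (∑ i, v i * MvPolynomial.eval (fun i => (x + s • v) i) (MvPolynomial.pderiv i p)) s := by
  induction p using MvPolynomial.induction_on with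
  | C c => simpa using hasDerivAt_const s c
  | add p q hp hq =>
    simp only [map_add, mul_add, Finset.sum_add_distrib]
    exact hp.add hq
  | mul_X p i hp =>
    have hX : HasDerivAt (fun s : ℝ => (x + s • v) i) (v i) s := by
      simpa using ((hasDerivAt_id s).mul_const (v i)).const_add (x i)
    have := hp.mul hX
    simp only [map_mul, MvPolynomial.eval_X]
    refine this.congr_deriv ?_
    simp only [Derivation.leibniz, MvPolynomial.pderiv_X, smul_eq_mul, map_add, map_mul,
      MvPolynomial.eval_X, mul_add, Finset.sum_add_distrib, Finset.sum_mul]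
    rw [add_comm]
    congr 1
    · rw [Finset.sum_eq_single i]
      · simp; ring
      · intro j _ hj; simp [hj.symm]
      · simp
    · exact Finset.sum_congr rfl fun j _ => by ring

@[fun_prop]
theorem continuous_eval_poly (p : Poly d) :
    Continuous fun x : Pt d => MvPolynomial.eval (fun i => x i) p :=
  p.continuous_eval.comp (by fun_prop)

/-- The two sides are components of vectors `F` and `N`. By `integral_deriv_edge` these have equal
inner products with all edges issuing from a fixed vertex, and such edges span the space because the
simplex is full-dimensional. -/
theorem integral_pderiv_eq_sum_facets [DecidableEq (Pt d)] {K : Finset (Pt d)}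
    (hind : AffineIndependent ℝ ((↑) : K → Pt d)) (hcard : K.card = d + 1) (p : Poly d)
    (i : Fin d) :
    ∫ x in convexHull ℝ (K : Set (Pt d)),
        MvPolynomial.eval (fun k => x k) (MvPolynomial.pderiv i p) =
      ∑ c ∈ K, (∫ x in convexHull ℝ ((K.erase c : Finset (Pt d)) : Set (Pt d)),
        MvPolynomial.eval (fun k => x k) p ∂μHE[d - 1]) * outwardNormal K (K.erase c) i := by
  have hcomp := Set.Finite.isCompact_convexHull (𝕜 := ℝ) K.finite_toSet
  let F : Pt d := WithLp.toLp 2 fun i => ∫ x in convexHull ℝ (K : Set (Pt d)),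
    MvPolynomial.eval (fun k => x k) (MvPolynomial.pderiv i p)
  let N : Pt d := ∑ c ∈ K, (∫ x in convexHull ℝ ((K.erase c : Finset (Pt d)) : Set (Pt d)),
    MvPolynomial.eval (fun k => x k) p ∂μHE[d - 1]) • outwardNormal K (K.erase c)
  suffices h : F = N by
    have := congrArg (fun v : Pt d => v i) h
    simpa [F, N, Finset.sum_apply] using this
  have hKne : K.Nonempty := Finset.card_pos.1 (by omega)
  obtain ⟨a, ha⟩ := hKne
  have hspan : vectorSpan ℝ (K : Set (Pt d)) = ⊤ := by
    have h1 := hind.affineSpan_eq_top_iff_card_eq_finrank_add_one.2 (by simpa using hcard)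
    have h2 : affineSpan ℝ (K : Set (Pt d)) = ⊤ := by simpa using h1
    rw [← direction_affineSpan, h2, AffineSubspace.direction_top]
  have key : innerSL ℝ F = innerSL ℝ N := by
    apply ContinuousLinearMap.coe_injective
    have hspan' := vectorSpan_eq_span_vsub_set_right ℝ (p := a) (s := (K : Set (Pt d))) ha
    rw [hspan] at hspan'
    refine LinearMap.ext_on hspan'.symm ?_
    rintro _ ⟨b, hb, rfl⟩
    have h := integral_deriv_edge hind hcard ha hb
      (f := fun x => MvPolynomial.eval (fun k => x k) p)
      (g := fun x => ∑ i, (b - a) i * MvPolynomial.eval (fun k => x k) (MvPolynomial.pderiv i p))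
      (by fun_prop) (by fun_prop) (fun x s => hasDerivAt_eval_line p x (b - a) s)
    rw [integral_finsetSum _ fun i _ => (Continuous.continuousOn
      (by fun_prop)).integrableOn_compact hcomp] at h
    simp only [integral_const_mul] at h
    simp only [ContinuousLinearMap.coe_coe, innerSL_apply_apply, vsub_eq_sub, N, sum_inner,
      inner_smul_left, RCLike.conj_to_real]
    calc ⟪F, b - a⟫ = _ := by
          simp [F, PiLp.inner_apply]
      _ = _ := h
      _ = _ := Finset.sum_congr rfl fun c _ => by rw [real_inner_comm]
  exact (innerSL_inj).1 key

end Divergence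

/-! ### Algebra of the local spaces `G_j` and `P_k` -/

section PolynomialAlgebra
open MvPolynomial

theorem IsHomogeneous.mem_restrictTotalDegree {p : Poly d} {n k : ℕ} (hp : p.IsHomogeneous n)
    (hn : n ≤ k) : p ∈ restrictTotalDegree (Fin d) ℝ k :=
  (MvPolynomial.mem_restrictTotalDegree _ _ _).2 (hp.totalDegree_le.trans hn)

theorem pderiv_mem_restrictTotalDegree {p : Poly d} {k : ℕ}
    (hp : p ∈ restrictTotalDegree (Fin d) ℝ k) (i : Fin d) :
    pderiv i p ∈ restrictTotalDegree (Fin d) ℝ (k - 1) := by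
  rw [MvPolynomial.mem_restrictTotalDegree] at hp
  rw [← sum_homogeneousComponent p, map_sum]
  refine Submodule.sum_mem _ fun n hn => ?_
  refine IsHomogeneous.mem_restrictTotalDegree (homogeneousComponent_isHomogeneous n p).pderiv ?_
  have := Finset.mem_range.1 hn
  omega

/-- The divergence as a linear map. -/
def divLinear (d : ℕ) : VecPoly d →ₗ[ℝ] Poly d :=
  ∑ i, (pderiv (R := ℝ) i).toLinearMap ∘ₗ LinearMap.proj i

theorem divLinear_apply (q : VecPoly d) : divLinear d q = q.div := by
  simp [divLinear, VecPoly.div]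

/-- Euler's identity for homogeneous polynomials, plus `d` copies of `p` from differentiating the
coordinates. -/
theorem div_mulPosition {p : Poly d} {n : ℕ} (hp : p.IsHomogeneous n) :
    (mulPosition d p).div = ((n + d : ℕ) : ℝ) • p := by
  have h := hp.sum_X_mul_pderiv
  simp only [VecPoly.div, mulPosition, LinearMap.coe_mk, AddHom.coe_mk, Derivation.leibniz,
    pderiv_X_self, smul_eq_mul, mul_one, Finset.sum_add_distrib, h, Finset.sum_const,
    Finset.card_univ, Fintype.card_fin]
  rw [Nat.cast_add, add_smul, Nat.cast_smul_eq_nsmul, Nat.cast_smul_eq_nsmul, add_comm]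

theorem mem_vecPolyLE {k : ℕ} {q : VecPoly d} :
    q ∈ vecPolyLE d k ↔ ∀ i, q i ∈ restrictTotalDegree (Fin d) ℝ k := by
  simp [vecPolyLE, Submodule.mem_pi]

theorem restrictTotalDegree_mono {k l : ℕ} (h : k ≤ l) :
    restrictTotalDegree (Fin d) ℝ k ≤ restrictTotalDegree (Fin d) ℝ l := fun p hp => by
  rw [MvPolynomial.mem_restrictTotalDegree] at *
  exact hp.trans h

theorem mulPosition_mem_vecPolyLE {p : Poly d} {n k : ℕ} (hp : p.IsHomogeneous n)
    (hn : n + 1 ≤ k) : mulPosition d p ∈ vecPolyLE d k :=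
  mem_vecPolyLE.2 fun i => IsHomogeneous.mem_restrictTotalDegree (hp.mul (isHomogeneous_X ℝ i)) hn

theorem mulPosition_mem_gradSpace (G : WGPair) {j n : ℕ} {p : Poly d} (hp : p.IsHomogeneous n)
    (hn : n ≤ j) : mulPosition d p ∈ G.gradSpace d j := by
  cases G with
  | BDM => exact mulPosition_mem_vecPolyLE hp (by omega)
  | RT =>
    rcases hn.lt_or_eq with h | rfl
    · exact Submodule.mem_sup_left (mulPosition_mem_vecPolyLE hp h)
    · exact Submodule.mem_sup_right ⟨p, hp, rfl⟩

/-- Each homogeneous component of degree `n` is the divergence of itself times `x / (n + d)`. This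
surjectivity makes the weak gradient injective on `V_0`. -/
theorem exists_div_eq (hd : 0 < d) (G : WGPair) {j : ℕ} {p : Poly d}
    (hp : p ∈ restrictTotalDegree (Fin d) ℝ j) : ∃ q ∈ G.gradSpace d j, q.div = p := by
  rw [MvPolynomial.mem_restrictTotalDegree] at hp
  refine ⟨∑ n ∈ Finset.range (p.totalDegree + 1),
    ((n + d : ℕ) : ℝ)⁻¹ • mulPosition d (homogeneousComponent n p), ?_, ?_⟩
  · refine Submodule.sum_mem _ fun n hn => Submodule.smul_mem _ _ ?_
    have := Finset.mem_range.1 hn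
    exact mulPosition_mem_gradSpace G (homogeneousComponent_isHomogeneous n p) (by omega)
  · conv_rhs => rw [← sum_homogeneousComponent p]
    rw [← divLinear_apply, map_sum]
    refine Finset.sum_congr rfl fun n _ => ?_
    have hne : ((n + d : ℕ) : ℝ) ≠ 0 := Nat.cast_ne_zero.2 (by omega)
    rw [map_smul, divLinear_apply, div_mulPosition (homogeneousComponent_isHomogeneous n p),
      smul_smul, inv_mul_cancel₀ hne, one_smul]

theorem div_mem_of_mem_vecPolyLE {k : ℕ} {q : VecPoly d} (hq : q ∈ vecPolyLE d k) :
    q.div ∈ restrictTotalDegree (Fin d) ℝ (k - 1) :=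
  Submodule.sum_mem _ fun i _ => pderiv_mem_restrictTotalDegree (mem_vecPolyLE.1 hq i) i

theorem div_mem_of_mem_gradSpace (G : WGPair) {j : ℕ} {q : VecPoly d}
    (hq : q ∈ G.gradSpace d j) : q.div ∈ restrictTotalDegree (Fin d) ℝ j := by
  cases G with
  | BDM => exact div_mem_of_mem_vecPolyLE hq
  | RT =>
    obtain ⟨q₁, hq₁, _, ⟨p, hp, rfl⟩, rfl⟩ := Submodule.mem_sup.1 hq
    rw [← divLinear_apply, map_add, divLinear_apply, divLinear_apply, div_mulPosition hp]
    exact add_mem (restrictTotalDegree_mono (Nat.sub_le j 1) (div_mem_of_mem_vecPolyLE hq₁))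
      (Submodule.smul_mem _ _ (IsHomogeneous.mem_restrictTotalDegree hp le_rfl))

theorem const_mem_gradSpace (G : WGPair) (j : ℕ) (c : Fin d → ℝ) :
    (fun i => C (c i)) ∈ G.gradSpace d j := by
  have h : ∀ k, (fun i => C (c i)) ∈ vecPolyLE d k := fun k =>
    mem_vecPolyLE.2 fun i => IsHomogeneous.mem_restrictTotalDegree (isHomogeneous_C _ _) k.zero_le
  cases G with
  | BDM => exact h _
  | RT => exact Submodule.mem_sup_left (h _)

theorem smul_sum_mem_of_mem_vecPolyLE {k : ℕ} {q : VecPoly d} (hq : q ∈ vecPolyLE d k)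
    (n : Fin d → ℝ) : ∑ i, n i • q i ∈ restrictTotalDegree (Fin d) ℝ k :=
  Submodule.sum_mem _ fun i _ => Submodule.smul_mem _ _ (mem_vecPolyLE.1 hq i)

/-- In the Raviart-Thomas case `p x` has degree `j + 1`, but `x · n` is constant on a flat face, so
the normal trace drops back to degree `j`. -/
theorem restrictTo_normal_mem_polyOn (G : WGPair) {j : ℕ} {q : VecPoly d}
    (hq : q ∈ G.gradSpace d j) {s : Set (Pt d)} {n : Fin d → ℝ} {c : ℝ}
    (hc : ∀ x ∈ s, ∑ i, n i * x i = c) :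
    restrictTo s (∑ i, n i • q i) ∈ polyOn s (G.faceDegree j) := by
  cases G with
  | BDM => exact ⟨_, smul_sum_mem_of_mem_vecPolyLE hq n, rfl⟩
  | RT =>
    obtain ⟨q₁, hq₁, _, ⟨p, hp, rfl⟩, rfl⟩ := Submodule.mem_sup.1 hq
    refine ⟨∑ i, n i • q₁ i + c • p, add_mem (smul_sum_mem_of_mem_vecPolyLE hq₁ n)
      (Submodule.smul_mem _ _ (IsHomogeneous.mem_restrictTotalDegree hp le_rfl)), ?_⟩
    funext x
    simp only [restrictTo, LinearMap.coe_mk, AddHom.coe_mk, mulPosition, Pi.add_apply, smul_add,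
      Finset.sum_add_distrib, map_add, add_right_inj]
    rw [← hc x x.2]
    simp only [map_sum, smul_eval, map_mul, eval_X, Finset.sum_mul]
    exact Finset.sum_congr rfl fun i _ => by ring

instance finiteDimensional_vecPolyLE (k : ℕ) : FiniteDimensional ℝ (vecPolyLE d k) := by
  let f : (∀ _ : Fin d, restrictTotalDegree (Fin d) ℝ k) →ₗ[ℝ] VecPoly d :=
    LinearMap.pi fun i => (Submodule.subtype _) ∘ₗ LinearMap.proj i
  have hle : vecPolyLE d k ≤ LinearMap.range f := fun q hq =>
    ⟨fun i => ⟨q i, mem_vecPolyLE.1 hq i⟩, rfl⟩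
  exact Submodule.finiteDimensional_of_le hle

instance finiteDimensional_gradSpace (G : WGPair) (j : ℕ) :
    FiniteDimensional ℝ (G.gradSpace d j) := by
  cases G with
  | BDM => exact finiteDimensional_vecPolyLE _
  | RT =>
    have : FiniteDimensional ℝ (homogeneousSubmodule (Fin d) ℝ j) :=
      Submodule.finiteDimensional_of_le (S₂ := restrictTotalDegree (Fin d) ℝ j) fun p hp =>
        IsHomogeneous.mem_restrictTotalDegree hp le_rfl
    exact Submodule.finite_sup _ _

instance finiteDimensional_polyOn (s : Set (Pt d)) (k : ℕ) : FiniteDimensional ℝ (polyOn s k) := by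
  unfold polyOn; infer_instance

/-- An interior point has a cube around it inside `s`, and a polynomial vanishing on a product of
infinite sets is zero. -/
theorem eq_zero_of_eval_eq_zero_on_interior {s : Set (Pt d)} (hs : (interior s).Nonempty)
    {p : Poly d} (hp : ∀ x ∈ s, eval (fun i => x i) p = 0) : p = 0 := by
  obtain ⟨x, hx⟩ := hs
  have hopen : IsOpen ((WithLp.toLp 2 : (Fin d → ℝ) → Pt d) ⁻¹' interior s) :=
    isOpen_interior.preimage (PiLp.continuous_toLp 2 _)
  obtain ⟨ε, hε, hball⟩ := Metric.isOpen_iff.1 hopen x.ofLp hx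
  refine funext_set (fun i => Metric.ball (x i) ε) (fun i => ?_) fun y hy => ?_
  · rw [Real.ball_eq_Ioo]
    exact Set.Ioo_infinite (by linarith)
  · rw [map_zero]
    rw [← ball_pi _ hε] at hy
    exact hp _ (interior_subset (hball hy))

end PolynomialAlgebra

/-! ### Measures of full support on cells and faces -/

section FullMeasure

theorem eq_zero_of_setIntegral_eq_zero {F : Type*} [TopologicalSpace F] [T2Space F]
    [MeasurableSpace F] [BorelSpace F] {ν : Measure F} [ν.IsOpenPosMeasure]
    [IsFiniteMeasureOnCompacts ν] {S : Set F} (hS : IsCompact S) (hcl : S ⊆ closure (interior S))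
    {f : F → ℝ} (hf : ContinuousOn f S) (h0 : ∀ x ∈ S, 0 ≤ f x) (hint : ∫ x in S, f x ∂ν = 0) :
    ∀ x ∈ S, f x = 0 := by
  have h := (setIntegral_eq_zero_iff_of_nonneg_ae
    ((ae_restrict_iff' hS.measurableSet).2 (Filter.Eventually.of_forall h0))
    (hf.integrableOn_compact' hS hS.measurableSet)).1 hint
  exact Measure.eqOn_of_ae_eq h hf continuousOn_const hcl

/-- The restriction of `μ` to `s` integrates all continuous functions on `s`, and has full
support. -/
structure IsFullOn (μ : Measure (Pt d)) (s : Set (Pt d)) : Prop where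
  measurableSet : MeasurableSet s
  integrable : ∀ g : s → ℝ, Continuous g → Integrable g (μ.comap ((↑) : s → Pt d))
  eq_zero : ∀ g : s → ℝ, Continuous g → (∀ x, 0 ≤ g x) → integralOn μ s g = 0 → g = 0

theorem integralOn_restrict {μ : Measure (Pt d)} {s : Set (Pt d)} (hs : MeasurableSet s)
    (f : Pt d → ℝ) : integralOn μ s (fun x => f x) = ∫ x in s, f x ∂μ :=
  integral_subtype_comap hs f

theorem IsFullOn.integralOn_add {μ : Measure (Pt d)} {s : Set (Pt d)} (h : IsFullOn μ s)
    {f g : s → ℝ} (hf : Continuous f) (hg : Continuous g) :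
    integralOn μ s (fun x => f x + g x) = integralOn μ s f + integralOn μ s g :=
  integral_add (h.integrable f hf) (h.integrable g hg)

theorem integralOn_const_mul {μ : Measure (Pt d)} {s : Set (Pt d)} (c : ℝ) (f : s → ℝ) :
    integralOn μ s (fun x => c * f x) = c * integralOn μ s f :=
  integral_const_mul c f

theorem IsFullOn.of_isCompact {μ : Measure (Pt d)} {s : Set (Pt d)} (hs : IsCompact s)
    (hfin : μ s < ⊤) (hpos : ∀ f : Pt d → ℝ, ContinuousOn f s → (∀ x ∈ s, 0 ≤ f x) →
      ∫ x in s, f x ∂μ = 0 → ∀ x ∈ s, f x = 0) : IsFullOn μ s where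
  measurableSet := hs.measurableSet
  integrable g hg := by
    have : CompactSpace s := isCompact_iff_compactSpace.1 hs
    have : IsFiniteMeasure (μ.comap ((↑) : s → Pt d)) := ⟨by
      rw [comap_subtype_coe_apply hs.measurableSet, Set.image_univ, Subtype.range_coe]
      exact hfin⟩
    exact hg.integrable_of_hasCompactSupport (HasCompactSupport.of_compactSpace g)
  eq_zero g hg h0 hint := by
    let f : Pt d → ℝ := Function.extend Subtype.val g 0
    have hfg : ∀ x : s, f x = g x := fun x => Subtype.val_injective.extend_apply g 0 x
    have hfc : ContinuousOn f s := by
      rw [continuousOn_iff_continuous_domRestrict]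
      convert hg using 1
      funext x; exact hfg x
    have hint' : ∫ x in s, f x ∂μ = 0 := by
      rw [← integralOn_restrict hs.measurableSet]
      simpa only [hfg] using hint
    funext x
    rw [← hfg x]
    exact hpos f hfc (fun y hy => by rw [hfg ⟨y, hy⟩]; exact h0 _) hint' x x.2

theorem IsFullOn.simplex {K : Finset (Pt d)} (hind : AffineIndependent ℝ ((↑) : K → Pt d))
    (hcard : K.card = d + 1) : IsFullOn volume (convexHull ℝ (K : Set (Pt d))) := by
  have hcomp := Set.Finite.isCompact_convexHull (𝕜 := ℝ) K.finite_toSet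
  refine IsFullOn.of_isCompact hcomp hcomp.measure_lt_top fun f hf h0 hint => ?_
  refine eq_zero_of_setIntegral_eq_zero hcomp ?_ hf h0 hint
  rw [(convex_convexHull ℝ _).closure_interior_eq_closure_of_nonempty_interior
    (interior_convexHull_nonempty hind hcard)]
  exact subset_closure

/-- A facet has empty interior in the ambient space, so positivity is transported through its chart
to the corner simplex, which is the closure of its interior. -/
theorem IsFullOn.facet [DecidableEq (Pt d)] {K : Finset (Pt d)}
    (hind : AffineIndependent ℝ ((↑) : K → Pt d)) (hcard : K.card = d + 1) (hd : 0 < d) {b : Pt d}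
    (hb : b ∈ K) :
    IsFullOn μHE[d - 1] (convexHull ℝ ((K.erase b : Finset (Pt d)) : Set (Pt d))) := by
  obtain ⟨a, ha⟩ : (K.erase b).Nonempty := by
    rw [← Finset.card_pos, Finset.card_erase_of_mem hb]; omega
  obtain ⟨r, hra, hr⟩ : ∃ r, a ∉ r ∧ K.erase b = insert a r :=
    ⟨(K.erase b).erase a, by simp, (Finset.insert_erase ha).symm⟩
  have hab : a ≠ b := (Finset.mem_erase.1 ha).1
  have hrb : b ∉ r := fun h => by
    have : b ∈ K.erase b := hr ▸ Finset.mem_insert_of_mem h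
    simp at this
  have hK : K = insert a (insert b r) := by
    rw [← Finset.insert_erase hb, hr, Finset.insert_comm]
  have hrc : r.card + 1 = d := by
    have := Finset.card_erase_of_mem hb
    rw [hr, Finset.card_insert_of_notMem hra] at this
    omega
  rw [hr]
  have hd1 : d - 1 = r.card := by omega
  rw [hK] at hind
  obtain ⟨k, hk, hfin, hF, -⟩ := exists_simplex_chart hra hrb hab hind (by simp [hrc])
  rw [hd1]
  have himg := chart_image_eq_convexHull a r
  refine IsFullOn.of_isCompact (Set.Finite.isCompact_convexHull (𝕜 := ℝ) (Finset.finite_toSet _))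
    hfin fun f hf h0 hint x hx => ?_
  rw [hF, mul_eq_zero, or_iff_right hk.ne'] at hint
  have hmaps : Set.MapsTo (chart a fun i : r => (i : Pt d) - a) (cornerSimplex r)
      (convexHull ℝ ((insert a r : Finset (Pt d)) : Set (Pt d))) := by
    rw [← himg]; exact Set.mapsTo_image _ _
  rw [← himg] at hx
  obtain ⟨t, ht, rfl⟩ := hx
  refine eq_zero_of_setIntegral_eq_zero (isCompact_cornerSimplex r) ?_
    (hf.comp (continuous_chart _ _).continuousOn hmaps) (fun t ht => h0 _ (hmaps ht)) hint t ht
  rw [(convex_cornerSimplex r).closure_interior_eq_closure_of_nonempty_interior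
    (interior_cornerSimplex_nonempty r)]
  exact subset_closure

end FullMeasure

/-! ### Riesz representation and local `L²` projections -/

section Projection

theorem continuous_restrictTo (s : Set (Pt d)) (p : Poly d) : Continuous (restrictTo s p) :=
  (continuous_eval_poly p).comp continuous_subtype_val

theorem continuous_of_mem_polyOn {s : Set (Pt d)} {k : ℕ} {r : s → ℝ} (hr : r ∈ polyOn s k) :
    Continuous r := by
  obtain ⟨p, -, rfl⟩ := hr
  exact continuous_restrictTo s p

/-- A bilinear form without isotropic vectors on a finite-dimensional space represents every
family of functionals. -/
theorem exists_linear_representative {V M : Type*} [AddCommGroup V] [Module ℝ V] [AddCommGroup M]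
    [Module ℝ M] [FiniteDimensional ℝ M] (B : M →ₗ[ℝ] M →ₗ[ℝ] ℝ) (hB : ∀ x, B x x = 0 → x = 0)
    (φ : V →ₗ[ℝ] M →ₗ[ℝ] ℝ) :
    ∃ W : V →ₗ[ℝ] M, ∀ v g, B g = φ v ↔ g = W v := by
  have hinj : Function.Injective B := by
    rw [← LinearMap.ker_eq_bot, LinearMap.ker_eq_bot']
    intro x hx
    exact hB x (by rw [hx, LinearMap.zero_apply])
  let e : M ≃ₗ[ℝ] (M →ₗ[ℝ] ℝ) :=
    LinearEquiv.ofInjectiveOfFinrankEq B hinj Subspace.dual_finrank_eq.symm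
  refine ⟨e.symm.toLinearMap ∘ₗ φ, fun v g => ?_⟩
  change B g = φ v ↔ g = e.symm (φ v)
  rw [LinearEquiv.eq_symm_apply]
  rfl

/-- The `L²(s, μ)` inner product on the polynomial functions on `s`. -/
def l2Form {μ : Measure (Pt d)} {s : Set (Pt d)} (h : IsFullOn μ s) (k l : ℕ) :
    polyOn s k →ₗ[ℝ] polyOn s l →ₗ[ℝ] ℝ :=
  LinearMap.mk₂ ℝ (fun p r => integralOn μ s fun x => (p : s → ℝ) x * (r : s → ℝ) x)
    (fun p q r => by
      simp only [Submodule.coe_add, Pi.add_apply, add_mul]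
      exact h.integralOn_add
        ((continuous_of_mem_polyOn p.2).mul (continuous_of_mem_polyOn r.2))
        ((continuous_of_mem_polyOn q.2).mul (continuous_of_mem_polyOn r.2)))
    (fun c p r => by
      simp only [Submodule.coe_smul, Pi.smul_apply, smul_eq_mul, mul_assoc]
      exact integralOn_const_mul _ _)
    (fun p q r => by
      simp only [Submodule.coe_add, Pi.add_apply, mul_add]
      exact h.integralOn_add
        ((continuous_of_mem_polyOn p.2).mul (continuous_of_mem_polyOn q.2))
        ((continuous_of_mem_polyOn p.2).mul (continuous_of_mem_polyOn r.2)))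
    (fun c p r => by
      simp only [Submodule.coe_smul, Pi.smul_apply, smul_eq_mul, mul_left_comm]
      exact integralOn_const_mul _ _)

theorem l2Form_apply {μ : Measure (Pt d)} {s : Set (Pt d)} (h : IsFullOn μ s) {k l : ℕ}
    (p : polyOn s k) (r : polyOn s l) :
    l2Form h k l p r = integralOn μ s fun x => (p : s → ℝ) x * (r : s → ℝ) x := rfl

/-- Since `f` is itself polynomial on `s`, of a possibly different degree `l`, the functional to be
represented is the mixed form `l2Form h l k` at `f`. -/
theorem existsUnique_isL2Proj {μ : Measure (Pt d)} {s : Set (Pt d)} (h : IsFullOn μ s) (k : ℕ)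
    {f : Pt d → ℝ} {l : ℕ} (hf : (fun x : s => f x) ∈ polyOn s l) :
    ∃! p, IsL2Proj μ s k f p := by
  obtain ⟨W, hW⟩ := exists_linear_representative (l2Form h k k) (fun x hx => by
    have h0 := h.eq_zero (fun y => (x : s → ℝ) y * (x : s → ℝ) y)
      ((continuous_of_mem_polyOn x.2).mul (continuous_of_mem_polyOn x.2))
      (fun y => mul_self_nonneg _) (by rwa [l2Form_apply] at hx)
    ext y
    exact mul_self_eq_zero.1 (congrFun h0 y)) (l2Form h l k)
  have key : ∀ g : polyOn s k, IsL2Proj μ s k f g ↔ g = W ⟨_, hf⟩ := fun g => by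
    rw [← hW]
    constructor
    · intro hg
      ext r
      rw [l2Form_apply, l2Form_apply]
      exact hg.2 r r.2
    · intro hg
      refine ⟨g.2, fun r hr => ?_⟩
      have := LinearMap.congr_fun hg ⟨r, hr⟩
      rwa [l2Form_apply, l2Form_apply] at this
  refine ⟨W ⟨_, hf⟩, (key _).2 rfl, fun p hp => ?_⟩
  exact congrArg Subtype.val ((key ⟨p, hp.1⟩).1 hp)

end Projection

variable {Ω : Set (Pt d)} {T : Mesh d Ω}

/-! ### Faces of mesh elements -/

section MeshGeometry

theorem Mesh.Cell.affineIndependent (K : T.Cell) : AffineIndependent ℝ ((↑) : K.verts → Pt d) :=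
  T.indep K.2.1

theorem Mesh.Cell.card_verts (K : T.Cell) : K.verts.card = d + 1 := K.2.2

theorem Mesh.Cell.isFullOn (K : T.Cell) : IsFullOn volume K.body :=
  IsFullOn.simplex K.affineIndependent K.card_verts

theorem exists_eq_erase_of_subset_of_card [DecidableEq (Pt d)] {K e : Finset (Pt d)} (h : e ⊆ K)
    (hK : K.card = d + 1) (he : e.card = d) : ∃ c ∈ K, e = K.erase c := by
  have h1 : (K \ e).card = 1 := by rw [Finset.card_sdiff_of_subset h]; omega
  obtain ⟨c, hc⟩ := Finset.card_eq_one.1 h1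
  refine ⟨c, (Finset.mem_sdiff.1 (hc ▸ Finset.mem_singleton_self c)).1, ?_⟩
  rw [Finset.erase_eq, ← hc, Finset.sdiff_sdiff_eq_self h]

theorem Mesh.Face.exists_cell (e : T.Face) : ∃ K : T.Cell, e.verts ⊆ K.verts := by
  obtain ⟨K, hK, hs, hc⟩ := T.pure_dim e.1 e.2.1
  exact ⟨⟨K, hK, hc⟩, hs⟩

theorem Mesh.Face.isFullOn (hd : 0 < d) (e : T.Face) : IsFullOn μHE[d - 1] e.body := by
  classical
  obtain ⟨K, hs⟩ := e.exists_cell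
  obtain ⟨c, hc, he⟩ := exists_eq_erase_of_subset_of_card hs K.card_verts e.2.2
  unfold Mesh.Face.body
  rw [he]
  exact IsFullOn.facet K.affineIndependent K.card_verts hd hc

theorem Mesh.Cell.mem_bdry {K : T.Cell} {e : T.Face} : e ∈ K.bdry ↔ e.verts ⊆ K.verts := by
  simp [Mesh.Cell.bdry]

-- Removing a vertex is a bijection onto the boundary faces of `K`. The facets belong to the mesh
-- because a complex is closed under nonempty subsets, and `0 < d` makes them nonempty.
open Classical in
theorem Mesh.Cell.sum_bdry (hd : 0 < d) (K : T.Cell) (g : Finset (Pt d) → ℝ) :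
    ∑ e ∈ K.bdry, g e.verts = ∑ c ∈ K.verts, g (K.verts.erase c) := by
  symm
  have hcard : ∀ c ∈ K.verts, (K.verts.erase c).card = d := fun c hc => by
    rw [Finset.card_erase_of_mem hc, K.card_verts, Nat.add_sub_cancel]
  have hmem : ∀ c ∈ K.verts, K.verts.erase c ∈ T.faces := fun c hc =>
    (T.isRelLowerSet_faces K.2.1).2 (Finset.erase_subset _ _)
      (Finset.card_pos.1 (by rw [hcard c hc]; exact hd))
  refine Finset.sum_bij (fun c hc => (⟨K.verts.erase c, hmem c hc, hcard c hc⟩ : T.Face))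
    ?_ ?_ ?_ ?_
  · intro c hc
    exact Mesh.Cell.mem_bdry.2 (Finset.erase_subset c K.verts)
  · intro c hc c' hc' h
    exact Finset.erase_injOn _ hc hc' (congrArg Subtype.val h)
  · intro e he
    obtain ⟨c, hc, h⟩ := exists_eq_erase_of_subset_of_card (Mesh.Cell.mem_bdry.1 he) K.card_verts e.2.2
    exact ⟨c, hc, Subtype.ext h.symm⟩
  · intro c hc
    rfl

theorem IsFullOn.integrableOn {μ : Measure (Pt d)} {s : Set (Pt d)} (h : IsFullOn μ s)
    {f : Pt d → ℝ} (hf : Continuous f) : IntegrableOn f s μ :=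
  (integrableOn_iff_comap_subtypeVal h.measurableSet).2
    (h.integrable _ (hf.comp continuous_subtype_val))

/-- The divergence theorem for polynomial vector fields on an element of the mesh. -/
theorem Mesh.Cell.integral_div (hd : 0 < d) (K : T.Cell) (F : VecPoly d) :
    ∫ x in K.body, MvPolynomial.eval (fun k => x k) F.div =
      ∑ e ∈ K.bdry, ∫ x in e.body,
        F.eval x ⬝ᵥ (outwardNormal K.verts e.verts).ofLp ∂μHE[d - 1] := by
  classical
  have h1 := K.sum_bdry hd fun e => ∫ x in convexHull ℝ (e : Set (Pt d)),
    F.eval x ⬝ᵥ (outwardNormal K.verts e).ofLp ∂μHE[d - 1]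
  refine Eq.trans ?_ h1.symm
  simp only [VecPoly.div, map_sum]
  rw [integral_finsetSum _ fun i _ => K.isFullOn.integrableOn (continuous_eval_poly _)]
  have h2 : ∀ i, ∫ x in K.body, MvPolynomial.eval (fun k => x k) (MvPolynomial.pderiv i (F i)) = _ :=
    fun i => integral_pderiv_eq_sum_facets K.affineIndependent K.card_verts (F i) i
  simp only [h2]
  rw [Finset.sum_comm]
  refine Finset.sum_congr rfl fun c hc => ?_
  simp only [dotProduct, VecPoly.eval]
  rw [integral_finsetSum _ fun i _ => ((IsFullOn.facet K.affineIndependent K.card_verts hd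
    hc).integrableOn (continuous_eval_poly _)).mul_const _]
  simp only [integral_mul_const]

end MeshGeometry

/-! ### Existence, uniqueness and linearity of the weak gradient -/

section WeakGradientExistence

/-- The integral of a polynomial over an element. -/
def cellIntegral (K : T.Cell) : Poly d →ₗ[ℝ] ℝ where
  toFun p := ∫ x in K.body, MvPolynomial.eval (fun k => x k) p
  map_add' p q := by
    simp only [map_add]
    exact integral_add (K.isFullOn.integrableOn (continuous_eval_poly _))
      (K.isFullOn.integrableOn (continuous_eval_poly _))
  map_smul' c p := by
    simp only [MvPolynomial.smul_eval, RingHom.id_apply, smul_eq_mul]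
    exact integral_const_mul _ _

/-- The `L²` inner product of polynomial vector fields on an element. -/
def cellForm (K : T.Cell) : VecPoly d →ₗ[ℝ] VecPoly d →ₗ[ℝ] ℝ :=
  ∑ i, (((LinearMap.mul ℝ (Poly d)).compl₁₂ (LinearMap.proj i) (LinearMap.proj i)).compr₂
    (cellIntegral K))

theorem cellForm_apply (K : T.Cell) (g q : VecPoly d) :
    cellForm K g q = ∫ x in K.body, g.eval x ⬝ᵥ q.eval x := by
  have h : cellForm K g q = cellIntegral K (∑ i, g i * q i) := by
    simp [cellForm, LinearMap.sum_apply]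
  rw [h]
  change ∫ x in K.body, MvPolynomial.eval (fun k => x k) (∑ i, g i * q i) = _
  simp [dotProduct, VecPoly.eval]

theorem cellForm_comm (K : T.Cell) (g q : VecPoly d) : cellForm K g q = cellForm K q g := by
  simp only [cellForm_apply, dotProduct_comm]

theorem eq_zero_of_integral_eval_eq_zero (K : T.Cell) {p : Poly d}
    (h0 : ∀ x : Pt d, 0 ≤ MvPolynomial.eval (fun k => x k) p)
    (h : ∫ x in K.body, MvPolynomial.eval (fun k => x k) p = 0) (x : Pt d) (hx : x ∈ K.body) :
    MvPolynomial.eval (fun k => x k) p = 0 := by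
  rw [← integralOn_restrict K.isFullOn.measurableSet] at h
  exact congrFun (K.isFullOn.eq_zero _ ((continuous_eval_poly p).comp continuous_subtype_val)
    (fun x => h0 x) h) ⟨x, hx⟩

theorem Mesh.Cell.interior_body_nonempty (K : T.Cell) : (interior K.body).Nonempty :=
  interior_convexHull_nonempty K.affineIndependent K.card_verts

/-- The sum of squares vanishes on `K`, so each component vanishes on a set with interior and is
zero as a formal polynomial. This matters because weak gradients are formal polynomials, not
functions on `K`. -/
theorem eq_zero_of_cellForm_self_eq_zero (K : T.Cell) {g : VecPoly d} (h : cellForm K g g = 0) :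
    g = 0 := by
  have h1 : ∫ x in K.body, MvPolynomial.eval (fun k => x k) (∑ i, g i * g i) = 0 := by
    rw [← h, cellForm_apply]
    simp [dotProduct, VecPoly.eval]
  have h2 := eq_zero_of_integral_eval_eq_zero K (fun x => by
    rw [map_sum]
    exact Finset.sum_nonneg fun i _ => by rw [map_mul]; exact mul_self_nonneg _) h1
  funext i
  refine eq_zero_of_eval_eq_zero_on_interior K.interior_body_nonempty fun x hx => ?_
  have h3 := h2 x hx
  simp only [map_sum, map_mul] at h3
  exact mul_self_eq_zero.1
    ((Finset.sum_eq_zero_iff_of_nonneg fun i _ => mul_self_nonneg _).1 h3 i (Finset.mem_univ i))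

variable (G : WGPair) (j : ℕ)

/-- The divergence on an element, as a map `G_j(K) → P_j(K)`. -/
def divOn (K : T.Cell) : G.gradSpace d j →ₗ[ℝ] polyOn K.body j :=
  ((restrictTo K.body ∘ₗ divLinear d) ∘ₗ Submodule.subtype _).codRestrict _ fun q =>
    ⟨_, div_mem_of_mem_gradSpace G q.2, by simp [divLinear_apply]⟩

theorem sum_outwardNormal_mul_eq (K : T.Cell) (e : T.Face) :
    ∃ c, ∀ x ∈ e.body, ∑ i, outwardNormal K.verts e.verts i * x i = c := by
  rcases e.body.eq_empty_or_nonempty with h | ⟨y, hy⟩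
  · exact ⟨0, by simp [h]⟩
  · refine ⟨∑ i, outwardNormal K.verts e.verts i * y i, fun x hx => ?_⟩
    have hsub : ∀ z ∈ e.body, z ∈ affineSpan ℝ (e.verts : Set (Pt d)) := fun z hz =>
      convexHull_subset_affineSpan _ hz
    have h := inner_outwardNormal_eq_zero (K := K.verts) (e := e.verts) (w := x - y) (by
      rw [← direction_affineSpan]
      exact AffineSubspace.vsub_mem_direction (hsub x hx) (hsub y hy))
    simp only [PiLp.inner_apply, RCLike.inner_apply, conj_trivial, PiLp.sub_apply, mul_sub,
      Finset.sum_sub_distrib] at h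
    linarith

/-- The normal trace on a face, as a map `G_j(K) → P_l(e)`. -/
def normalTraceOn (K : T.Cell) (e : T.Face) :
    G.gradSpace d j →ₗ[ℝ] polyOn e.body (G.faceDegree j) :=
  ((restrictTo e.body ∘ₗ ∑ i, outwardNormal K.verts e.verts i • LinearMap.proj i) ∘ₗ
    Submodule.subtype _).codRestrict _ fun q => by
      obtain ⟨c, hc⟩ := sum_outwardNormal_mul_eq K e
      have := restrictTo_normal_mem_polyOn G q.2 hc
      simpa using this

theorem normalTraceOn_apply (K : T.Cell) (e : T.Face) (q : G.gradSpace d j) (x : e.body) :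
    (normalTraceOn G j K e q : e.body → ℝ) x =
      (q : VecPoly d).eval x ⬝ᵥ (outwardNormal K.verts e.verts).ofLp := by
  simp [normalTraceOn, restrictTo, dotProduct, VecPoly.eval, MvPolynomial.smul_eval, mul_comm]

theorem divOn_apply (K : T.Cell) (q : G.gradSpace d j) :
    (divOn G j K q : K.body → ℝ) = restrictTo K.body (q : VecPoly d).div :=
  congrArg (restrictTo K.body) (divLinear_apply _)

/-- The interior component of a weak function on an element. -/
def cellComponent (K : T.Cell) : Vh T G j →ₗ[ℝ] polyOn K.body j :=
  ((LinearMap.proj K ∘ₗ LinearMap.fst ℝ _ _) ∘ₗ Submodule.subtype _).codRestrict _ fun v => v.2.1 K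

/-- The boundary component of a weak function on a face. -/
def faceComponent (e : T.Face) : Vh T G j →ₗ[ℝ] polyOn e.body (G.faceDegree j) :=
  ((LinearMap.proj e ∘ₗ LinearMap.snd ℝ _ _) ∘ₗ Submodule.subtype _).codRestrict _
    fun v => v.2.2.1 e

/-- The right-hand side of the definition of the weak gradient. -/
def weakGradientFunctional (hd : 0 < d) (K : T.Cell) :
    Vh T G j →ₗ[ℝ] G.gradSpace d j →ₗ[ℝ] ℝ :=
  -((l2Form K.isFullOn j j).compl₁₂ (cellComponent G j K) (divOn G j K)) +
    ∑ e ∈ K.bdry, (l2Form (e.isFullOn hd) (G.faceDegree j) (G.faceDegree j)).compl₁₂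
      (faceComponent G j e) (normalTraceOn G j K e)

theorem weakGradientFunctional_apply (hd : 0 < d) (K : T.Cell) (v : Vh T G j)
    (q : G.gradSpace d j) :
    weakGradientFunctional G j hd K v q =
      - integralOn volume K.body
          (fun x => (v : WeakFun T).1 K x * restrictTo K.body (q : VecPoly d).div x) +
      ∑ e ∈ K.bdry, integralOn μHE[d - 1] e.body
        (fun x => (v : WeakFun T).2 e x *
          ((q : VecPoly d).eval x ⬝ᵥ (outwardNormal K.verts e.verts).ofLp)) := by
  simp only [weakGradientFunctional, LinearMap.add_apply, LinearMap.neg_apply, LinearMap.sum_apply,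
    LinearMap.compl₁₂_apply, l2Form_apply, divOn_apply, normalTraceOn_apply]
  rfl

/-- Besides existence and uniqueness, this records linear dependence on `v`, on which the
bilinearity of `a_h` rests. -/
theorem exists_weakGradient_linear (hd : 0 < d) (K : T.Cell) :
    ∃ W : Vh T G j →ₗ[ℝ] G.gradSpace d j, ∀ (v : Vh T G j) (g : VecPoly d),
      IsWeakGradient G j v K g ↔ g = W v := by
  let B := (cellForm K).compl₁₂ (G.gradSpace d j).subtype (G.gradSpace d j).subtype
  obtain ⟨W, hW⟩ := exists_linear_representative B
    (fun x hx => Subtype.ext (eq_zero_of_cellForm_self_eq_zero K hx))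
    (weakGradientFunctional G j hd K)
  have key : ∀ (v : Vh T G j) (g : G.gradSpace d j), IsWeakGradient G j v K g ↔ g = W v := by
    intro v g
    rw [← hW]
    constructor
    · intro hg
      ext q
      rw [weakGradientFunctional_apply, ← hg.2 q q.2, ← cellForm_apply]
      rfl
    · intro hg
      refine ⟨g.2, fun q hq => ?_⟩
      have := LinearMap.congr_fun hg ⟨q, hq⟩
      rw [weakGradientFunctional_apply] at this
      rw [← this, ← cellForm_apply]
      rfl
  refine ⟨W, fun v g => ⟨fun h => ?_, ?_⟩⟩
  · exact congrArg Subtype.val ((key v ⟨g, h.1⟩).1 h)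
  · rintro rfl
    exact (key v _).2 rfl

theorem existsUnique_isWeakGradient (hd : 0 < d) {v : WeakFun T} (hv : v ∈ Vh T G j)
    (K : T.Cell) : ∃! g, IsWeakGradient G j v K g := by
  obtain ⟨W, hW⟩ := exists_weakGradient_linear (T := T) G j hd K
  exact ⟨W ⟨v, hv⟩, (hW ⟨v, hv⟩ _).2 rfl, fun g hg => (hW ⟨v, hv⟩ g).1 hg⟩

variable {G j}

theorem isWeakGradient_weakGradient (hd : 0 < d) {v : WeakFun T} (hv : v ∈ Vh T G j)
    (K : T.Cell) : IsWeakGradient G j v K (weakGradient G j v K) :=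
  theUnique_spec (existsUnique_isWeakGradient G j hd hv K)

theorem IsWeakGradient.eq_weakGradient (hd : 0 < d) {v : WeakFun T} (hv : v ∈ Vh T G j)
    {K : T.Cell} {g : VecPoly d} (h : IsWeakGradient G j v K g) : weakGradient G j v K = g :=
  (existsUnique_isWeakGradient G j hd hv K).unique (isWeakGradient_weakGradient hd hv K) h

end WeakGradientExistence

/-! ### The form `a_h` and the projector `P_0` -/

section BilinearForm

/-- Multiplication of a polynomial vector field by a constant matrix. -/
def matrixMul (M : Matrix (Fin d) (Fin d) ℝ) : VecPoly d →ₗ[ℝ] VecPoly d :=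
  LinearMap.pi fun i => ∑ j, M i j • LinearMap.proj j

theorem matrixMul_apply (M : Matrix (Fin d) (Fin d) ℝ) (q : VecPoly d) (i : Fin d) :
    matrixMul M q i = ∑ j, M i j • q j := by
  simp [matrixMul]

theorem eval_matrixMul (M : Matrix (Fin d) (Fin d) ℝ) (q : VecPoly d) (x : Pt d) :
    (matrixMul M q).eval x = M.mulVec (q.eval x) := by
  funext i
  simp [VecPoly.eval, matrixMul_apply, Matrix.mulVec, dotProduct, MvPolynomial.smul_eval]

/-- The boundary of a convex set is Lebesgue-null. The coefficient matrix is prescribed only in the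
interior of an element, and this suffices under the integral. -/
theorem Mesh.Cell.ae_mem_interior (K : T.Cell) : ∀ᵐ x, x ∈ K.body → x ∈ interior K.body := by
  have h : volume (frontier K.body) = 0 := (convex_convexHull ℝ _).addHaar_frontier volume
  filter_upwards [measure_eq_zero_iff_ae_notMem.1 h] with x hx hxK
  by_contra hxi
  exact hx ⟨subset_closure hxK, hxi⟩

variable {G : WGPair} {j : ℕ} {A : Pt d → Matrix (Fin d) (Fin d) ℝ}
  {M : T.Cell → Matrix (Fin d) (Fin d) ℝ}

theorem ah_eq_sum_cellForm (hM : ∀ K : T.Cell, ∀ x ∈ interior K.body, A x = M K)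
    (u v : WeakFun T) :
    ah G j A u v =
      ∑ K, cellForm K (matrixMul (M K) (weakGradient G j u K)) (weakGradient G j v K) := by
  refine Finset.sum_congr rfl fun K _ => ?_
  rw [cellForm_apply]
  refine setIntegral_congr_ae K.isFullOn.measurableSet ?_
  filter_upwards [K.ae_mem_interior] with x hx hxK
  rw [eval_matrixMul, hM K x (hx hxK)]

/-- `weakGradient` is a choice with default value `0`, so its linearity is available through `V_h`,
where the weak gradient is unique; the form is built on that space. -/
theorem exists_ah_bilinear (hd : 0 < d)
    (hM : ∀ K : T.Cell, ∀ x ∈ interior K.body, A x = M K) :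
    ∃ b : Vh T G j →ₗ[ℝ] Vh T G j →ₗ[ℝ] ℝ, ∀ u v : Vh T G j, b u v = ah G j A (u : WeakFun T) (v : WeakFun T) := by
  choose W hW using fun K : T.Cell => exists_weakGradient_linear G j hd K
  have hwg : ∀ (K : T.Cell) (v : Vh T G j), weakGradient G j v K = W K v := fun K v =>
    IsWeakGradient.eq_weakGradient hd v.2 ((hW K v _).2 rfl)
  refine ⟨∑ K, (cellForm K).compl₁₂ (matrixMul (M K) ∘ₗ Submodule.subtype _ ∘ₗ W K)
    (Submodule.subtype _ ∘ₗ W K), fun u v => ?_⟩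
  rw [ah_eq_sum_cellForm hM]
  simp [LinearMap.sum_apply, hwg]

theorem ah_sub_left (hd : 0 < d) (hM : ∀ K : T.Cell, ∀ x ∈ interior K.body, A x = M K)
    {u v ζ : WeakFun T} (hu : u ∈ Vh T G j) (hv : v ∈ Vh T G j) (hζ : ζ ∈ Vh T G j) :
    ah G j A (u - v) ζ = ah G j A u ζ - ah G j A v ζ := by
  obtain ⟨b, hb⟩ := exists_ah_bilinear (G := G) (j := j) hd hM
  have h := hb (⟨u, hu⟩ - ⟨v, hv⟩) ⟨ζ, hζ⟩
  rw [map_sub, LinearMap.sub_apply, hb, hb] at h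
  exact h.symm

theorem dotProduct_eval_matrixMul (N : Matrix (Fin d) (Fin d) ℝ) (g : VecPoly d)
    (x : Pt d) : MvPolynomial.eval (fun k => x k) (∑ i, matrixMul N g i * g i) =
      g.eval x ⬝ᵥ N.mulVec (g.eval x) := by
  rw [dotProduct_comm, ← eval_matrixMul]
  simp [dotProduct, VecPoly.eval]

theorem cellForm_matrixMul_eq_integral (K : T.Cell) (N : Matrix (Fin d) (Fin d) ℝ)
    (g : VecPoly d) : cellForm K (matrixMul N g) g =
      ∫ x in K.body, MvPolynomial.eval (fun k => x k) (∑ i, matrixMul N g i * g i) := by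
  rw [cellForm_apply]
  simp [dotProduct, VecPoly.eval]

theorem eq_zero_of_cellForm_matrixMul_eq_zero (K : T.Cell) {N : Matrix (Fin d) (Fin d) ℝ} {α : ℝ}
    (hα : 0 < α) (hN : ∀ ξ : Fin d → ℝ, α * (ξ ⬝ᵥ ξ) ≤ ξ ⬝ᵥ N.mulVec ξ) {g : VecPoly d}
    (h : cellForm K (matrixMul N g) g = 0) : g = 0 := by
  have hnn : ∀ ξ : Fin d → ℝ, 0 ≤ ξ ⬝ᵥ ξ := fun ξ =>
    Finset.sum_nonneg fun i _ => mul_self_nonneg _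
  rw [cellForm_matrixMul_eq_integral] at h
  have h2 := eq_zero_of_integral_eval_eq_zero K (fun x => by
    rw [dotProduct_eval_matrixMul]
    exact (mul_nonneg hα.le (hnn _)).trans (hN _)) h
  apply eq_zero_of_cellForm_self_eq_zero K
  rw [cellForm_apply, setIntegral_congr_fun (g := fun _ => (0 : ℝ)) K.isFullOn.measurableSet,
    integral_zero]
  intro x hx
  have h3 := h2 x hx
  rw [dotProduct_eval_matrixMul] at h3
  have h4 := hN (g.eval x)
  rw [h3] at h4
  exact le_antisymm (nonpos_of_mul_nonpos_right h4 hα) (hnn _)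

theorem cellForm_matrixMul_self_nonneg (K : T.Cell) {N : Matrix (Fin d) (Fin d) ℝ} {α : ℝ}
    (hα : 0 < α) (hN : ∀ ξ : Fin d → ℝ, α * (ξ ⬝ᵥ ξ) ≤ ξ ⬝ᵥ N.mulVec ξ) (g : VecPoly d) :
    0 ≤ cellForm K (matrixMul N g) g := by
  rw [cellForm_matrixMul_eq_integral]
  refine integral_nonneg fun x => ?_
  change 0 ≤ MvPolynomial.eval (fun k => x k) _
  rw [dotProduct_eval_matrixMul]
  exact (mul_nonneg hα.le (Finset.sum_nonneg fun i _ => mul_self_nonneg _)).trans (hN _)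

/-- Test with a field `q` whose divergence is `v₀` on `K`. There is no boundary part, so the
definition of the weak gradient reduces to `0 = -(v₀, v₀)_K`. -/
theorem eq_zero_of_weakGradient_eq_zero (hd : 0 < d) {v : WeakFun T} (hv : v ∈ V0 T G j)
    (h : ∀ K, weakGradient G j v K = 0) : v = 0 := by
  have hv2 : v.2 = 0 := LinearMap.mem_ker.1 hv.2
  refine Prod.ext ?_ hv2
  funext K
  obtain ⟨p, hp, hpv⟩ := hv.1.1 K
  obtain ⟨q, hq, hqp⟩ := exists_div_eq hd G hp
  have h1 := (isWeakGradient_weakGradient hd hv.1 K).2 q hq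
  rw [← cellForm_apply, h K, map_zero, LinearMap.zero_apply, hqp, hpv, hv2] at h1
  have h2 : integralOn volume K.body (fun x => v.1 K x * v.1 K x) = 0 := by
    simpa [integralOn] using h1.symm
  have h3 := K.isFullOn.eq_zero _
    ((continuous_of_mem_polyOn (hv.1.1 K)).mul (continuous_of_mem_polyOn (hv.1.1 K)))
    (fun x => mul_self_nonneg _) h2
  funext x
  exact mul_self_eq_zero.1 (congrFun h3 x)

instance finiteDimensional_V0 : FiniteDimensional ℝ (V0 T G j) := by
  let f : V0 T G j →ₗ[ℝ] ∀ K : T.Cell, polyOn K.body j :=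
    LinearMap.pi fun K => cellComponent G j K ∘ₗ Submodule.inclusion inf_le_left
  refine FiniteDimensional.of_injective f ?_
  intro u v huv
  refine Subtype.ext (Prod.ext ?_ ?_)
  · funext K
    exact congrArg Subtype.val (congrFun huv K)
  · exact (LinearMap.mem_ker.1 u.2.2).trans (LinearMap.mem_ker.1 v.2.2).symm

/-- By coercivity, `a_h(x, x) = 0` forces the weak gradient of `x` to vanish on every element, hence
`x = 0` on `V_0`; the form is then representing. -/
theorem existsUnique_isP0 (hd : 0 < d) {α : ℝ} (hα : 0 < α)
    (hM : ∀ K : T.Cell, ∀ x ∈ interior K.body, A x = M K)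
    (hpos : ∀ K : T.Cell, ∀ ξ : Fin d → ℝ, α * (ξ ⬝ᵥ ξ) ≤ ξ ⬝ᵥ (M K).mulVec ξ)
    {v : WeakFun T} (hv : v ∈ Vh T G j) : ∃! u, IsP0 G j A v u := by
  obtain ⟨b, hb⟩ := exists_ah_bilinear (G := G) (j := j) hd hM
  let incl : V0 T G j →ₗ[ℝ] Vh T G j := Submodule.inclusion inf_le_left
  have hbi : ∀ u ζ : V0 T G j, b (incl u) (incl ζ) = ah G j A (u : WeakFun T) (ζ : WeakFun T) :=
    fun u ζ => hb (incl u) (incl ζ)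
  obtain ⟨W, hW⟩ := exists_linear_representative (b.compl₁₂ incl incl) (fun x hx => by
    have h1 : ah G j A (x : WeakFun T) (x : WeakFun T) = 0 := (hbi x x).symm.trans hx
    rw [ah_eq_sum_cellForm hM, Finset.sum_eq_zero_iff_of_nonneg fun K _ =>
      cellForm_matrixMul_self_nonneg K hα (hpos K) _] at h1
    exact Subtype.ext (eq_zero_of_weakGradient_eq_zero hd x.2 fun K =>
      eq_zero_of_cellForm_matrixMul_eq_zero K hα (hpos K) (h1 K (Finset.mem_univ K))))
    (b.compl₁₂ LinearMap.id incl)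
  have key : ∀ u : V0 T G j, IsP0 G j A v u ↔ u = W ⟨v, hv⟩ := fun u => by
    rw [← hW]
    constructor
    · intro hu
      ext ζ
      exact (hbi u ζ).trans ((hu.2 ζ ζ.2).trans (hb ⟨v, hv⟩ (incl ζ)).symm)
    · intro hu
      refine ⟨u.2, fun ζ hζ => ?_⟩
      exact (hbi u ⟨ζ, hζ⟩).symm.trans
        ((LinearMap.congr_fun hu ⟨ζ, hζ⟩).trans (hb ⟨v, hv⟩ (incl ⟨ζ, hζ⟩)))
  refine ⟨W ⟨v, hv⟩, (key _).2 rfl, fun u hu => ?_⟩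
  exact congrArg Subtype.val ((key ⟨u, hu.1⟩).1 hu)

end BilinearForm

/-! ### Projections of conforming functions and the identity -/

section Prolongation

variable {G : WGPair} {j : ℕ} {w : Pt d → ℝ}

theorem existsUnique_isL2Proj_cell (hw : w ∈ conformingP1 T) (k : ℕ) (K : T.Cell) :
    ∃! p, IsL2Proj volume K.body k w p :=
  existsUnique_isL2Proj K.isFullOn k (hw.2.2 K)

theorem existsUnique_isL2Proj_face (hd : 0 < d) (hw : w ∈ conformingP1 T) (k : ℕ) (e : T.Face) :
    ∃! p, IsL2Proj μHE[d - 1] e.body k w p := by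
  obtain ⟨K, hs⟩ := e.exists_cell
  obtain ⟨p, hp, hpw⟩ := hw.2.2 K
  have hsub : e.body ⊆ K.body := convexHull_mono (by exact_mod_cast hs)
  refine existsUnique_isL2Proj (e.isFullOn hd) k (l := 1) ⟨p, hp, ?_⟩
  funext x
  exact congrFun hpw ⟨x, hsub x.2⟩

theorem Q0_mem_V0 (hw : w ∈ conformingP1 T) : Q0 T j w ∈ V0 T G j :=
  ⟨⟨fun K => (theUnique_spec (existsUnique_isL2Proj_cell hw j K)).1, fun _ => zero_mem _,
    fun _ _ => rfl⟩, rfl⟩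

theorem Qb_mem_Vb (hd : 0 < d) (hΩ : IsOpen Ω) (hw : w ∈ conformingP1 T) :
    Qb T G j w ∈ Vb T G j := by
  have hspec := fun e => theUnique_spec (existsUnique_isL2Proj_face hd hw (G.faceDegree j) e)
  refine ⟨⟨fun _ => zero_mem _, fun e => (hspec e).1, fun e he => ?_⟩, rfl⟩
  -- An open set misses its frontier, so `w` vanishes on a boundary face and `0` is its projection
  -- there.
  have hw0 : ∀ x : e.body, w x = 0 := fun x => hw.2.1 x fun hx =>
    (he x.2).2 (hΩ.interior_eq.symm ▸ hx)
  refine (existsUnique_isL2Proj_face hd hw (G.faceDegree j) e).unique (hspec e)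
    ⟨zero_mem _, fun r _ => ?_⟩
  simp [integralOn, hw0]

theorem Qh_mem_Vh (hd : 0 < d) (hΩ : IsOpen Ω) (hw : w ∈ conformingP1 T) :
    Qh T G j w ∈ Vh T G j :=
  add_mem (Q0_mem_V0 hw).1 (Qb_mem_Vb hd hΩ hw).1

theorem exists_pderiv_eq_C {p : Poly d} (hp : p ∈ MvPolynomial.restrictTotalDegree (Fin d) ℝ 1)
    (i : Fin d) : ∃ c, MvPolynomial.pderiv i p = MvPolynomial.C c := by
  have h := pderiv_mem_restrictTotalDegree hp i
  rw [MvPolynomial.mem_restrictTotalDegree, Nat.sub_self, Nat.le_zero] at h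
  exact ⟨_, MvPolynomial.totalDegree_eq_zero_iff_eq_C.1 h⟩

/-- The weak gradient of `Q_h w` is the (constant) gradient of `w`. -/
theorem exists_weakGradient_Qh_eq_const (hd : 0 < d) (hΩ : IsOpen Ω) (hw : w ∈ conformingP1 T)
    (K : T.Cell) :
    ∃ c : Fin d → ℝ, weakGradient G j (Qh T G j w) K = fun i => MvPolynomial.C (c i) := by
  obtain ⟨p, hp, hpw⟩ := hw.2.2 K
  choose c hc using exists_pderiv_eq_C hp
  have hwp : ∀ x (hx : x ∈ K.body), w x = MvPolynomial.eval (fun k => x k) p := fun x hx =>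
    (congrFun hpw ⟨x, hx⟩).symm
  refine ⟨c, IsWeakGradient.eq_weakGradient hd (Qh_mem_Vh hd hΩ hw)
    ⟨const_mem_gradSpace G j c, fun q hq => ?_⟩⟩
  -- `div q` lies in `P_j(K)`, so `Q_0 w` may be replaced by `w`, which is `p` on `K`.
  have hcell : integralOn volume K.body
      (fun x => (Qh T G j w).1 K x * restrictTo K.body q.div x) =
        ∫ x in K.body, MvPolynomial.eval (fun k => x k) (p * q.div) := by
    have h := (theUnique_spec (existsUnique_isL2Proj_cell hw j K)).2 _
      ⟨q.div, div_mem_of_mem_gradSpace G hq, rfl⟩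
    have h1 : (Qh T G j w).1 K = l2Proj volume K.body j w := add_zero _
    rw [h1, ← integralOn_restrict K.isFullOn.measurableSet]
    refine h.trans ?_
    congr 1
    funext x
    rw [hwp x x.2, map_mul]
    rfl
  -- Likewise `q · n` lies in `P_l(e)`, so `Q_b w` may be replaced by `p`.
  have hface : ∀ e ∈ K.bdry, integralOn μHE[d - 1] e.body
      (fun x => (Qh T G j w).2 e x * (q.eval x ⬝ᵥ (outwardNormal K.verts e.verts).ofLp)) =
        ∫ x in e.body, VecPoly.eval (fun i => p * q i) x ⬝ᵥ
          (outwardNormal K.verts e.verts).ofLp ∂μHE[d - 1] := by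
    intro e he
    have hsub : e.body ⊆ K.body := convexHull_mono (by exact_mod_cast Mesh.Cell.mem_bdry.1 he)
    have h := (theUnique_spec (existsUnique_isL2Proj_face hd hw (G.faceDegree j) e)).2 _
      (normalTraceOn G j K e ⟨q, hq⟩).2
    simp only [normalTraceOn_apply] at h
    have h1 : (Qh T G j w).2 e = l2Proj μHE[d - 1] e.body (G.faceDegree j) w := zero_add _
    rw [h1, ← integralOn_restrict (e.isFullOn hd).measurableSet]
    refine h.trans ?_
    congr 1
    funext x
    rw [hwp x (hsub x.2)]
    simp [dotProduct, VecPoly.eval, Finset.mul_sum, mul_assoc]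
  -- The boundary terms are the flux of `p q`; in `div (p q) = p div q + ∇p · q` the first summand
  -- cancels the cell term.
  rw [hcell, Finset.sum_congr rfl hface, ← K.integral_div hd, ← integral_neg, ← integral_add]
  · congr 1
    funext x
    simp only [VecPoly.div, Derivation.leibniz, map_sum, map_mul, map_add, hc, smul_eq_mul,
      Finset.sum_add_distrib, ← Finset.mul_sum, dotProduct, VecPoly.eval, MvPolynomial.eval_C]
    rw [neg_add_cancel_left]
    exact Finset.sum_congr rfl fun i _ => mul_comm _ _
  · exact (K.isFullOn.integrableOn (continuous_eval_poly _)).neg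
  · exact K.isFullOn.integrableOn (continuous_eval_poly _)

/-- A constant field belongs to `G_j` and is divergence-free, and `ζ` has no boundary part, so both
terms defining the weak gradient vanish. -/
theorem cellForm_weakGradient_const_eq_zero (hd : 0 < d) {ζ : WeakFun T} (hζ : ζ ∈ V0 T G j)
    (K : T.Cell) (c : Fin d → ℝ) :
    cellForm K (fun i => MvPolynomial.C (c i)) (weakGradient G j ζ K) = 0 := by
  have hζ2 : ζ.2 = 0 := LinearMap.mem_ker.1 hζ.2
  rw [cellForm_comm, cellForm_apply, (isWeakGradient_weakGradient hd hζ.1 K).2 _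
    (const_mem_gradSpace G j c), hζ2]
  simp [integralOn, VecPoly.div]

/-- `Q_h w` is `a_h`-orthogonal to `V_0`, so `-Q_0 w` has the defining property of `P_0 Q_b w`. -/
theorem Qh_eq_prolongR (hd : 0 < d) (hΩ : IsOpen Ω) {A : Pt d → Matrix (Fin d) (Fin d) ℝ}
    {M : T.Cell → Matrix (Fin d) (Fin d) ℝ} {α : ℝ} (hα : 0 < α)
    (hM : ∀ K : T.Cell, ∀ x ∈ interior K.body, A x = M K)
    (hpos : ∀ K : T.Cell, ∀ ξ : Fin d → ℝ, α * (ξ ⬝ᵥ ξ) ≤ ξ ⬝ᵥ (M K).mulVec ξ)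
    (hw : w ∈ conformingP1 T) : Qh T G j w = prolongR T G j A w := by
  have hb := (Qb_mem_Vb (G := G) (j := j) hd hΩ hw).1
  have h0 := Q0_mem_V0 (G := G) (j := j) hw
  have hP : IsP0 G j A (Qb T G j w) (-Q0 T j w) := by
    refine ⟨neg_mem h0, fun ζ hζ => ?_⟩
    have hsum : ah G j A (Qh T G j w) ζ = 0 := by
      rw [ah_eq_sum_cellForm hM]
      refine Finset.sum_eq_zero fun K _ => ?_
      obtain ⟨c, hc⟩ := exists_weakGradient_Qh_eq_const (G := G) (j := j) hd hΩ hw K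
      -- Piecewise constancy of the coefficient is what keeps the flux constant, hence an admissible
      -- divergence-free test field.
      have hconst : matrixMul (M K) (fun i => MvPolynomial.C (c i)) =
          fun i => MvPolynomial.C ((M K).mulVec c i) := by
        funext i
        simp [matrixMul_apply, Matrix.mulVec, dotProduct, MvPolynomial.smul_eq_C_mul]
      rw [hc, hconst]
      exact cellForm_weakGradient_const_eq_zero hd hζ K _
    have hsub : Qh T G j w = Qb T G j w - -Q0 T j w := by
      rw [sub_neg_eq_add, add_comm, Qh]
    rw [hsub, ah_sub_left hd hM hb (neg_mem h0.1) hζ.1] at hsum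
    exact (sub_eq_zero.1 hsum).symm
  have huniq := existsUnique_isP0 hd hα hM hpos hb
  have hP0 : P0 G j A (Qb T G j w) = -Q0 T j w := huniq.unique (theUnique_spec huniq) hP
  rw [prolongR, hP0, sub_neg_eq_add, Qh, add_comm]

end Prolongation

end WeakGalerkin

end

theorem mainTheorem5 (d : ℕ) (hd : d = 2 ∨ d = 3)
    (Ω : Set (WeakGalerkin.Pt d)) (hΩ : IsOpen Ω) (hΩc : IsConnected Ω)
    (T : WeakGalerkin.Mesh d Ω) (G : WeakGalerkin.WGPair) (j : ℕ)
    (A : WeakGalerkin.Pt d → Matrix (Fin d) (Fin d) ℝ)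
    (hsymm : ∀ x ∈ Ω, (A x).IsSymm)
    (α β : ℝ) (hα : 0 < α) (hβ : 0 < β)
    (hbound : ∀ x ∈ Ω, ∀ ξ : Fin d → ℝ,
      α * (ξ ⬝ᵥ ξ) ≤ ξ ⬝ᵥ (A x).mulVec ξ ∧ ξ ⬝ᵥ (A x).mulVec ξ ≤ β * (ξ ⬝ᵥ ξ))
    (hconst : ∀ K : T.Cell, ∃ M : Matrix (Fin d) (Fin d) ℝ, ∀ x ∈ interior K.body, A x = M) :
    -- the weak gradient of every `v ∈ V_h` is well defined
    (∀ v ∈ WeakGalerkin.Vh T G j, ∀ K : T.Cell,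
      ∃! g, WeakGalerkin.IsWeakGradient G j v K g) ∧
    -- the projector `P_0 : V_b → V_0` is well defined
    (∀ v ∈ WeakGalerkin.Vb T G j, ∃! u, WeakGalerkin.IsP0 G j A v u) ∧
    ∀ w ∈ WeakGalerkin.conformingP1 T,
      -- the local projections of `w` are well defined, `Q_b w ∈ V_b`, and `Q_h w ∈ V_h`
      (∀ K : T.Cell, ∃! p, WeakGalerkin.IsL2Proj volume K.body j w p) ∧
      (∀ e : T.Face, ∃! p, WeakGalerkin.IsL2Proj μHE[d - 1] e.body (G.faceDegree j) w p) ∧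
      WeakGalerkin.Qb T G j w ∈ WeakGalerkin.Vb T G j ∧
      WeakGalerkin.Qh T G j w ∈ WeakGalerkin.Vh T G j ∧
      -- the identity `Q_h w = Π_r w`
      WeakGalerkin.Qh T G j w = WeakGalerkin.prolongR T G j A w := by
  have hd0 : 0 < d := by omega
  choose M hM using hconst
  have hpos : ∀ K : T.Cell, ∀ ξ : Fin d → ℝ, α * (ξ ⬝ᵥ ξ) ≤ ξ ⬝ᵥ (M K).mulVec ξ := by
    intro K ξ
    -- Coercivity is assumed pointwise on `Ω`; an interior point of `K` lies in `Ω`, and there the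
    -- coefficient equals `M K`.
    obtain ⟨x, hx⟩ := K.interior_body_nonempty
    rw [← hM K x hx]
    exact (hbound x (T.interior_subset K.1 K.2.1 K.2.2 hx) ξ).1
  exact ⟨fun v hv K => WeakGalerkin.existsUnique_isWeakGradient G j hd0 hv K,
    fun v hv => WeakGalerkin.existsUnique_isP0 hd0 hα hM hpos hv.1,
    fun w hw => ⟨WeakGalerkin.existsUnique_isL2Proj_cell hw j,
      WeakGalerkin.existsUnique_isL2Proj_face hd0 hw _, WeakGalerkin.Qb_mem_Vb hd0 hΩ hw,
      WeakGalerkin.Qh_mem_Vh hd0 hΩ hw, WeakGalerkin.Qh_eq_prolongR hd0 hΩ hα hM hpos hw⟩⟩
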